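/- Let $\alpha,\beta>-1$, let $\mathbb D$ be the open unit disc, $\mathbb D^*=\mathbb D\setminus\{0\}$, and let $\mathscr B$ be the beta function. Let $\mu_{\alpha,\beta}$ be the measure on $\mathbb D$ given by $$d\mu_{\alpha,\beta}(z)=\frac{1}{\pi\,\mathscr B(\alpha+1,\beta+1)}\,|z|^{2\beta}(1-|z|^2)^{\alpha}\,dx\,dy ,$$ and let $\mathcal A^2_{\alpha,\beta}(\mathbb D^*)$ be the space of holomorphic functions $f$ on $\mathbb D^*$ with $\int_{\mathbb D}|f|^2\,d\mu_{\alpha,\beta}<\infty$, with the inner product $\langle f,g\rangle=\int_{\mathbb D} f\bar g\,d\mu_{\alpha,\beta}$. Let $m$ be the largest integer strictly smaller than $\beta+1$, and for $0<r<1$ put $$\mathscr J_{\alpha,\beta,2}(r)=\frac{2r^{2m}}{\mathscr B(\alpha+1,\beta+1)}\int_r^1 t^{2\beta-2m+1}(1-t^2)^{\alpha}\,dt .$$ Then $\mathcal A^2_{\alpha,\beta}(\mathbb D^*)$ has a reproducing kernel $\mathbb K_{\alpha,\beta}$: for every $z\in\mathbb D^*$ the function $\mathbb K_{\alpha,\beta}(\cdot,z)$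 belongs to the space and $f(z)=\langle f,\mathbb K_{\alpha,\beta}(\cdot,z)\rangle$ for all $f$ in the space. Moreover, for every $\xi\in\mathbb C$ with $0<|\xi|\le 1$, the integral $$\mathcal Tf(z)=\int_{-1}^1 f(\xi x)\,\mathbb K_{\alpha,\beta}(z,\xi x)\,\mathscr J_{\alpha,\beta,2}(|x|)\,dx$$ converges absolutely for all $f\in\mathcal A^2_{\alpha,\beta}(\mathbb D^*)$ and $z\in\mathbb D^*$, and it defines a positive (in particular self-adjoint) bounded linear operator $\mathcal T$ on $\mathcal A^2_{\alpha,\beta}(\mathbb D^*)$ with $$\|\mathcal T\|\le \pi\,|\xi|^{-2m}.$$ In particular $\|\mathcal T\|\le\pi$ if $|\xi|=1$ or $-1<\beta\le 0$. -/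

import Mathlib

open MeasureTheory

noncomputable section

namespace MeromorphicBergman

/-- The punctured unit disc of the complex plane. -/
def puncturedDisc : Set ℂ := Metric.ball 0 1 \ {0}

/-- The measure on the unit disc with density
`|z|^(2β) (1 - |z|²)^α / B(α+1, β+1)` with respect to the normalized area `(1/π) dx dy`,
where `B` is Euler's beta function. -/
def diskMeasure (α β : ℝ) : Measure ℂ :=
  (volume.restrict (Metric.ball (0 : ℂ) 1)).withDensity fun z =>
    ENNReal.ofReal ((ProbabilityTheory.beta (α + 1) (β + 1))⁻¹ * Real.pi⁻¹ *
      (‖z‖ ^ (2 * β) * (1 - ‖z‖ ^ 2) ^ α))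

/-- Functions that are holomorphic on the punctured disc and square integrable for
`diskMeasure α β`. A function on the punctured disc is represented by its extension
by zero to the whole plane. -/
def bergmanSubmodule (α β : ℝ) : Submodule ℂ (ℂ → ℂ) where
  carrier := {f | DifferentiableOn ℂ f puncturedDisc ∧ (∀ z ∉ puncturedDisc, f z = 0) ∧
    MemLp f 2 (diskMeasure α β)}
  zero_mem' := ⟨differentiableOn_const 0, fun _ _ => rfl, MemLp.zero⟩
  add_mem' := fun {f g} hf hg =>
    ⟨hf.1.add hg.1, fun z hz => by simp [hf.2.1 z hz, hg.2.1 z hz], hf.2.2.add hg.2.2⟩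
  smul_mem' := fun c f hf =>
    ⟨hf.1.const_smul c, fun z hz => by simp [hf.2.1 z hz], hf.2.2.const_smul c⟩

/-- The Bergman type space of square integrable holomorphic functions on the punctured disc.
It is a type of its own so that it does not inherit the topology of pointwise convergence;
its norm is the one of `L²`. -/
def BergmanSpace {α β : ℝ} (_ : -1 < α) (_ : -1 < β) : Type := bergmanSubmodule α β

variable {α β : ℝ} {hα : -1 < α} {hβ : -1 < β}

namespace BergmanSpace

instance : AddCommGroup (BergmanSpace hα hβ) :=
  inferInstanceAs (AddCommGroup (bergmanSubmodule α β))

instance : Module ℂ (BergmanSpace hα hβ) :=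
  inferInstanceAs (Module ℂ (bergmanSubmodule α β))

instance : CoeFun (BergmanSpace hα hβ) fun _ => ℂ → ℂ := ⟨fun f => f.1⟩

/-- The inclusion of the Bergman space into `L²`. -/
def toL2 : BergmanSpace hα hβ →ₗ[ℂ] Lp ℂ 2 (diskMeasure α β) where
  toFun f := f.2.2.2.toLp f.1
  map_add' f g := MemLp.toLp_add f.2.2.2 g.2.2.2
  map_smul' c f := MemLp.toLp_const_smul c f.2.2.2

lemma toL2_injective : Function.Injective (toL2 : BergmanSpace hα hβ → _) := by
  intro f g h
  have h1 : f.1 =ᵐ[diskMeasure α β] g.1 := (MemLp.toLp_eq_toLp_iff f.2.2.2 g.2.2.2).1 h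
  have hopen : IsOpen puncturedDisc := Metric.isOpen_ball.sdiff isClosed_singleton
  have h2 : f.1 =ᵐ[volume.restrict puncturedDisc] g.1 := by
    rw [diskMeasure, Filter.EventuallyEq, ae_withDensity_iff (by fun_prop)] at h1
    have h3 := ae_restrict_of_ae_restrict_of_subset (s := puncturedDisc) Set.sdiff_subset h1
    filter_upwards [h3, ae_restrict_mem hopen.measurableSet] with z hz hzD
    apply hz
    have hz0 : 0 < ‖z‖ := norm_pos_iff.2 hzD.2
    have hz1 : ‖z‖ < 1 := by simpa using hzD.1
    have hb : 0 < ProbabilityTheory.beta (α + 1) (β + 1) :=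
      ProbabilityTheory.beta_pos (by linarith) (by linarith)
    have hs : 0 < 1 - ‖z‖ ^ 2 := by nlinarith
    have hpi := Real.pi_pos
    rw [ENNReal.ofReal_ne_zero_iff]
    positivity
  have h4 : Set.EqOn f.1 g.1 puncturedDisc :=
    Measure.eqOn_of_ae_eq h2 f.2.1.continuousOn g.2.1.continuousOn
      (by rw [hopen.interior_eq]; exact subset_closure)
  apply Subtype.ext
  funext z
  by_cases hz : z ∈ puncturedDisc
  · exact h4 hz
  · rw [f.2.2.1 z hz, g.2.2.1 z hz]

instance : NormedAddCommGroup (BergmanSpace hα hβ) :=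
  NormedAddCommGroup.induced _ _ toL2 toL2_injective

instance : InnerProductSpace ℂ (BergmanSpace hα hβ) where
  norm_smul_le c f := by
    change ‖toL2 (c • f)‖ ≤ ‖c‖ * ‖toL2 f‖
    rw [map_smul]
    exact norm_smul_le _ _
  inner f g := inner ℂ (toL2 f) (toL2 g)
  norm_sq_eq_re_inner f := norm_sq_eq_re_inner (𝕜 := ℂ) (toL2 f)
  conj_inner_symm f g := inner_conj_symm _ _
  add_left f g h := by rw [map_add]; exact inner_add_left _ _ _
  smul_left f g c := by rw [map_smul]; exact inner_smul_left _ _ _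

/-- The inner product is the one of `L²`; as usual in Mathlib it is conjugate linear in the
first argument. -/
lemma inner_eq_integral (f g : BergmanSpace hα hβ) :
    inner ℂ f g = ∫ z, g z * (starRingEnd ℂ) (f z) ∂(diskMeasure α β) := by
  change inner ℂ (toL2 f) (toL2 g) = _
  rw [L2.inner_def]
  apply integral_congr_ae
  filter_upwards [f.2.2.2.coeFn_toLp, g.2.2.2.coeFn_toLp] with z hf hg
  change inner ℂ ((f.2.2.2.toLp f.1) z) ((g.2.2.2.toLp g.1) z) = _
  rw [hf, hg, RCLike.inner_apply]

end BergmanSpace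

/-- `K` is the reproducing kernel of the Bergman space: for every `z` in the punctured disc,
`K(·, z)` belongs to the space and `f z = ⟨f, K(·, z)⟩ = ∫ f(w) conj (K(w, z)) dμ(w)`
for all `f` in the space. -/
def IsReproducingKernel (hα : -1 < α) (hβ : -1 < β) (K : ℂ → ℂ → ℂ) : Prop :=
  ∀ z ∈ puncturedDisc, ∃ k : BergmanSpace hα hβ, (∀ w ∈ puncturedDisc, k w = K w z) ∧
    ∀ f : BergmanSpace hα hβ, inner ℂ k f = f z

open Classical in
/-- The reproducing (Bergman) kernel: `bergmanKernel hα hβ w z` is the value at `w` of the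
element of the Bergman space that represents the evaluation at `z`. -/
def bergmanKernel (hα : -1 < α) (hβ : -1 < β) (w z : ℂ) : ℂ :=
  if h : ∃ k : BergmanSpace hα hβ, ∀ f : BergmanSpace hα hβ, inner ℂ k f = f z
  then h.choose w else 0

open Classical in
/-- The largest order `m_{p,β}` of a pole at the origin: the largest integer that is
strictly smaller than `2(β+1)/p`. -/
def maxPoleOrder (p β : ℝ) : ℤ :=
  if ∃ n : ℕ, 2 * (β + 1) / p = n then ⌊2 * (β + 1) / p⌋ - 1 else ⌊2 * (β + 1) / p⌋

/-- The weight `J_{α,β,p}`. -/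
def weightJ (α β p r : ℝ) : ℝ :=
  2 * r ^ (p * maxPoleOrder p β) / ProbabilityTheory.beta (α + 1) (β + 1) *
    ∫ t in r..1, t ^ (2 * β - p * maxPoleOrder p β + 1) * (1 - t ^ 2) ^ α

/-- The integrand of the Toeplitz operator, as a function of `x ∈ (-1, 1)`. -/
def toeplitzIntegrand (hα : -1 < α) (hβ : -1 < β) (ξ : ℂ) (f : ℂ → ℂ) (z : ℂ) (x : ℝ) : ℂ :=
  f (ξ * x) * bergmanKernel hα hβ z (ξ * x) * weightJ α β 2 |x|

end MeromorphicBergman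

end

/-!
The operator is `T = S† S`, where `S f x = f (ξ x)` restricts a function to a diameter and takes
values in `L²((-1, 1), J(|x|) dx)`. Since point evaluations are represented by the kernel,
`(T f) z = ⟪k_z, S† S f⟫ = ⟪S k_z, S f⟫`, which is the integral in the statement. Positivity is then
automatic, and `‖T‖ = ‖S‖²`.

The bound `‖S f‖² ≤ π ‖ξ‖ ^ (-2 m) ‖f‖²` comes from the following facts.

* A function `f` of the space has a pole of order at most `m` at the origin, so that
  `g z = z ^ m f z` is holomorphic on the disc (`BergmanSpace.exists_holomorphic_eq_pow_mul`). This
  is Riemann's theorem on removable singularities; the growth estimate it needs is the sub-mean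
  value inequality on the disc of radius `‖z‖ / 2` about `z`.
* `J(r)` is `2 r ^ (2 m) / B` times the integral over `t ∈ (r, 1)` of `radialWeight`. Exchanging the
  integrals (`BergmanSpace.lintegral_diameter_le`) leaves for each `t` the integral of
  `x ↦ ‖g (ξ x)‖²` over `[-t, t]`.
* The Fejér–Riesz inequality (`fejer_riesz`), together with the monotonicity of quadratic means in
  the radius (`integral_normSq_circle_le`), bounds this by `t / 2` times the integral of `‖g‖²` over
  the circle of radius `t`. Integrating in polar coordinates gives `‖f‖²`.

The kernel exists because evaluations are bounded, locally uniformly in the point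
(`BergmanSpace.exists_norm_apply_le`), which also makes the space complete.
-/

open scoped ENNReal Real ComplexConjugate

noncomputable section

namespace MeromorphicBergman

variable {α β : ℝ} {hα : -1 < α} {hβ : -1 < β}

/-! ### Holomorphic functions on discs -/

lemma exp_ofReal_mul_I_mem_ball {R : ℝ} (hR : 1 < R) {w : ℂ} (hw : ‖w‖ ≤ 1) (θ : ℝ) :
    w * Complex.exp (θ * Complex.I) ∈ Metric.ball (0 : ℂ) R := by
  simpa [Complex.norm_exp_ofReal_mul_I] using hw.trans_lt hR

lemma continuous_comp_circle {G : ℂ → ℂ} {R : ℝ} (hR : 1 < R)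
    (hG : DifferentiableOn ℂ G (Metric.ball 0 R)) {w : ℂ} (hw : ‖w‖ ≤ 1) :
    Continuous fun θ : ℝ => G (w * Complex.exp (θ * Complex.I)) :=
  hG.continuousOn.comp_continuous (by fun_prop) (exp_ofReal_mul_I_mem_ball hR hw)

lemma integral_circle_rotate (F : ℂ → ℝ) {w : ℂ} (hw : ‖w‖ = 1) :
    ∫ θ in (-π)..π, F (w * Complex.exp (θ * Complex.I)) =
      ∫ θ in (-π)..π, F (Complex.exp (θ * Complex.I)) := by
  have hper : Function.Periodic (fun θ : ℝ => F (Complex.exp (θ * Complex.I))) (2 * π) := by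
    intro θ
    have := Complex.exp_periodic (θ * Complex.I)
    simp only [Complex.ofReal_add, Complex.ofReal_mul, add_mul, Complex.ofReal_ofNat]
    rw [this]
  have hw' : w = Complex.exp (w.arg * Complex.I) := by
    simpa [hw] using (Complex.norm_mul_exp_arg_mul_I w).symm
  have h1 : (fun θ : ℝ => F (w * Complex.exp (θ * Complex.I))) =
      fun θ : ℝ => F (Complex.exp (((θ + w.arg : ℝ) : ℂ) * Complex.I)) := by
    funext θ
    congr 1
    conv_lhs => rw [hw', ← Complex.exp_add]
    congr 1
    push_cast
    ring
  rw [h1, intervalIntegral.integral_comp_add_right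
    (f := fun θ : ℝ => F (Complex.exp (θ * Complex.I)))]
  have := hper.intervalIntegral_add_eq (-π + w.arg) (-π)
  rw [show -π + w.arg + 2 * π = π + w.arg by ring, show -π + 2 * π = π by ring] at this
  exact this

/-- Differentiation under the integral sign for the correlation of a holomorphic function with a
continuous function on the circle. -/
lemma differentiableAt_integral_circle {G : ℂ → ℂ} {R : ℝ}
    (hG : DifferentiableOn ℂ G (Metric.ball 0 R)) {c : ℝ → ℂ} (hc : Continuous c) {w : ℂ}
    (hw : ‖w‖ < R) :
    DifferentiableAt ℂ (fun w : ℂ => ∫ θ in (-π)..π, G (w * Complex.exp (θ * Complex.I)) * c θ)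
      w := by
  obtain ⟨r, hwr, hrR⟩ := exists_between hw
  have hmem : ∀ x : ℂ, ‖x‖ < R → ∀ θ : ℝ,
      x * Complex.exp (θ * Complex.I) ∈ Metric.ball (0 : ℂ) R := fun x hx θ => by
    simpa [Complex.norm_exp_ofReal_mul_I] using hx
  have hdc : ContinuousOn (deriv G) (Metric.ball 0 R) :=
    (hG.deriv Metric.isOpen_ball).continuousOn
  obtain ⟨C, hC⟩ := (isCompact_closedBall (0 : ℂ) r).exists_bound_of_continuousOn
    (hdc.mono (Metric.closedBall_subset_ball hrR))
  have hcont : ∀ x : ℂ, ‖x‖ < R →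
      Continuous fun θ : ℝ => G (x * Complex.exp (θ * Complex.I)) * c θ := fun x hx =>
    (hG.continuousOn.comp_continuous (by fun_prop) (hmem x hx)).mul hc
  refine (intervalIntegral.hasDerivAt_integral_of_dominated_loc_of_deriv_le
    (F := fun w θ => G (w * Complex.exp (θ * Complex.I)) * c θ)
    (F' := fun w θ => deriv G (w * Complex.exp (θ * Complex.I)) *
      Complex.exp (θ * Complex.I) * c θ)
    (bound := fun θ => C * ‖c θ‖) (s := Metric.ball 0 r)
    (Metric.isOpen_ball.mem_nhds (by simpa using hwr)) ?_
    ((hcont w hw).intervalIntegrable _ _) ?_ ?_ ?_ ?_).2.differentiableAt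
  · filter_upwards [Metric.isOpen_ball.mem_nhds (show w ∈ Metric.ball (0 : ℂ) r by simpa using hwr)]
      with x hx
    exact (hcont x ((by simpa using hx : ‖x‖ < r).trans hrR)).aestronglyMeasurable
  · exact (((hdc.comp_continuous (by fun_prop) (hmem w hw)).mul (by fun_prop)).mul
      hc).aestronglyMeasurable
  · refine Filter.Eventually.of_forall fun θ _ x hx => ?_
    rw [norm_mul, norm_mul, Complex.norm_exp_ofReal_mul_I, mul_one]
    gcongr
    apply hC
    simpa [Complex.norm_exp_ofReal_mul_I] using (by simpa using hx : ‖x‖ < r).le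
  · exact (continuous_const.mul hc.norm).intervalIntegrable _ _
  · refine Filter.Eventually.of_forall fun θ _ x hx => ?_
    have hx' := hmem x ((by simpa using hx : ‖x‖ < r).trans hrR) θ
    have h1 := (hG.differentiableAt (Metric.isOpen_ball.mem_nhds hx')).hasDerivAt
    have h2 : HasDerivAt (fun x : ℂ => x * Complex.exp (θ * Complex.I))
        (Complex.exp (θ * Complex.I)) x := by
      simpa using (hasDerivAt_id x).mul_const (Complex.exp (θ * Complex.I))
    exact (h1.comp x h2).mul_const (c θ)

/-- The quadratic means of a holomorphic function over concentric circles increase with the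
radius. The correlation `w ↦ ∫ G(w e^{iθ}) conj (G(ξ e^{iθ})) dθ` is holomorphic, its value at `ξ`
is the mean over the circle of radius `‖ξ‖`, and on the unit circle it is at most the average of
the two means to be compared; the maximum principle concludes. -/
lemma integral_normSq_circle_le {G : ℂ → ℂ} {R : ℝ} (hR : 1 < R)
    (hG : DifferentiableOn ℂ G (Metric.ball 0 R)) {ξ : ℂ} (hξ : ‖ξ‖ ≤ 1) :
    ∫ θ in (-π)..π, ‖G (ξ * Complex.exp (θ * Complex.I))‖ ^ 2 ≤
      ∫ θ in (-π)..π, ‖G (Complex.exp (θ * Complex.I))‖ ^ 2 := by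
  set M : ℂ → ℝ := fun w => ∫ θ in (-π)..π, ‖G (w * Complex.exp (θ * Complex.I))‖ ^ 2 with hM
  have hcξ := continuous_comp_circle hR hG hξ
  have hpi : -π ≤ π := by linarith [Real.pi_pos]
  set φ : ℂ → ℂ := fun w => ∫ θ in (-π)..π, G (w * Complex.exp (θ * Complex.I)) *
    conj (G (ξ * Complex.exp (θ * Complex.I))) with hφ
  have hd : DifferentiableOn ℂ φ (Metric.ball 0 R) := fun w hw =>
    (differentiableAt_integral_circle hG (Complex.continuous_conj.comp hcξ)
      (by simpa using hw)).differentiableWithinAt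
  have hφξ : φ ξ = (M ξ : ℂ) := by
    simp only [hφ, hM, Complex.mul_conj']
    exact_mod_cast intervalIntegral.integral_ofReal
  have hbound : ∀ w ∈ frontier (Metric.ball (0 : ℂ) 1),
      ‖φ w‖ ≤ ((∫ θ in (-π)..π, ‖G (Complex.exp (θ * Complex.I))‖ ^ 2) + M ξ) / 2 := by
    intro w hw
    have hw1 : ‖w‖ = 1 := by simpa [frontier_ball] using hw
    have hsq : ∀ v : ℂ, ‖v‖ ≤ 1 →
        Continuous fun θ : ℝ => ‖G (v * Complex.exp (θ * Complex.I))‖ ^ 2 := fun v hv =>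
      (continuous_comp_circle hR hG hv).norm.pow 2
    rw [← integral_circle_rotate (fun z => ‖G z‖ ^ 2) hw1]
    simp only [hM]
    rw [← intervalIntegral.integral_add ((hsq w hw1.le).intervalIntegrable _ _)
      ((hsq ξ hξ).intervalIntegrable _ _), ← intervalIntegral.integral_div]
    refine intervalIntegral.norm_integral_le_of_norm_le hpi
      (Filter.Eventually.of_forall fun θ _ => ?_)
      ((((hsq w hw1.le).add (hsq ξ hξ)).div_const 2).intervalIntegrable _ _)
    rw [norm_mul, RCLike.norm_conj]
    nlinarith [sq_nonneg (‖G (w * Complex.exp (θ * Complex.I))‖ -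
      ‖G (ξ * Complex.exp (θ * Complex.I))‖)]
  have hcl : closure (Metric.ball (0 : ℂ) 1) ⊆ Metric.ball 0 R :=
    Metric.closure_ball_subset_closedBall.trans (Metric.closedBall_subset_ball hR)
  have hmax := Complex.norm_le_of_forall_mem_frontier_norm_le Metric.isBounded_ball
    (hd.mono hcl).diffContOnCl hbound (z := ξ)
    (by rw [closure_ball _ one_ne_zero]; simpa using hξ)
  rw [hφξ, Complex.norm_real] at hmax
  have := (le_abs_self _).trans hmax
  linarith

/-- The Fejér–Riesz inequality, with its sharp constant `1 / 2`. The function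
`h z = G z * conj (G (conj z))` is holomorphic and equals `‖G‖ ^ 2` on the real axis; by Cauchy's
theorem its integral over the diameter is the one over the upper half circle. -/
lemma fejer_riesz {G : ℂ → ℂ} {R : ℝ} (hR : 1 < R)
    (hG : DifferentiableOn ℂ G (Metric.ball 0 R)) :
    ∫ x in (-1 : ℝ)..1, ‖G x‖ ^ 2 ≤
      (1 / 2) * ∫ θ in (-π)..π, ‖G (Complex.exp (θ * Complex.I))‖ ^ 2 := by
  set h : ℂ → ℂ := fun z => G z * conj (G (conj z)) with hh
  have hd : DifferentiableOn ℂ h (Metric.ball 0 R) := by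
    intro z hz
    have hz' : conj z ∈ Metric.ball (0 : ℂ) R := by simpa using hz
    have h1 := hG.differentiableAt (Metric.isOpen_ball.mem_nhds hz)
    have h2 := (hG.differentiableAt (Metric.isOpen_ball.mem_nhds hz')).conj_conj
    rw [Complex.conj_conj] at h2
    exact (h1.mul h2).differentiableWithinAt
  obtain ⟨H, hH⟩ := hd.isExactOn_ball
  have hreal : ∀ x : ℝ, h x = ((‖G x‖ ^ 2 : ℝ) : ℂ) := fun x => by
    simp [hh, Complex.mul_conj']
  have hxmem : ∀ x ∈ Set.uIcc (-1 : ℝ) 1, (x : ℂ) ∈ Metric.ball (0 : ℂ) R := by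
    intro x hx
    rw [Set.uIcc_of_le (by norm_num)] at hx
    simpa using (abs_le.2 hx).trans_lt hR
  have hexp : ∀ θ : ℝ, Complex.exp (θ * Complex.I) ∈ Metric.ball (0 : ℂ) R := fun θ => by
    simpa using exp_ofReal_mul_I_mem_ball hR (w := 1) (by simp) θ
  have hGc : Continuous fun θ : ℝ => G (Complex.exp (θ * Complex.I)) :=
    hG.continuousOn.comp_continuous (by fun_prop) hexp
  have hsq : Continuous fun θ : ℝ => ‖G (Complex.exp (θ * Complex.I))‖ ^ 2 := hGc.norm.pow 2
  have hsq' : Continuous fun θ : ℝ => ‖G (Complex.exp ((-θ : ℝ) * Complex.I))‖ ^ 2 :=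
    hsq.comp continuous_neg
  have hdiam : ∫ x in (-1 : ℝ)..1, h x = H 1 - H (-1) := by
    have := intervalIntegral.integral_eq_sub_of_hasDerivAt (a := -1) (b := 1)
      (f := fun x : ℝ => H x) (f' := fun x : ℝ => h x)
      (fun x hx => (hH x (hxmem x hx)).comp_ofReal)
      (ContinuousOn.intervalIntegrable (hd.continuousOn.comp (by fun_prop) hxmem))
    simpa using this
  have harc : ∫ θ in (0 : ℝ)..π, h (Complex.exp (θ * Complex.I)) *
      (Complex.exp (θ * Complex.I) * Complex.I) = H (-1) - H 1 := by
    have hder : ∀ θ : ℝ, HasDerivAt (fun θ : ℝ => H (Complex.exp (θ * Complex.I)))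
        (h (Complex.exp (θ * Complex.I)) * (Complex.exp (θ * Complex.I) * Complex.I)) θ := by
      intro θ
      have h2 : HasDerivAt (fun z : ℂ => Complex.exp (z * Complex.I))
          (Complex.exp (θ * Complex.I) * Complex.I) (θ : ℂ) := by
        simpa using ((hasDerivAt_id (θ : ℂ)).mul_const Complex.I).cexp
      exact ((hH _ (hexp θ)).comp (θ : ℂ) h2).comp_ofReal
    have := intervalIntegral.integral_eq_sub_of_hasDerivAt (a := 0) (b := π)
      (fun θ _ => hder θ)
      (((hd.continuousOn.comp_continuous (by fun_prop) hexp).mul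
        (by fun_prop)).intervalIntegrable _ _)
    simpa using this
  have hkey : ((∫ x in (-1 : ℝ)..1, ‖G x‖ ^ 2 : ℝ) : ℂ) =
      -∫ θ in (0 : ℝ)..π, h (Complex.exp (θ * Complex.I)) *
        (Complex.exp (θ * Complex.I) * Complex.I) := by
    rw [harc, neg_sub, ← hdiam, ← intervalIntegral.integral_ofReal]
    simp only [hreal]
  have hle : ∫ x in (-1 : ℝ)..1, ‖G x‖ ^ 2 ≤
      ∫ θ in (0 : ℝ)..π, (‖G (Complex.exp (θ * Complex.I))‖ ^ 2 +
        ‖G (Complex.exp ((-θ : ℝ) * Complex.I))‖ ^ 2) / 2 := by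
    refine (le_abs_self _).trans ?_
    rw [← Real.norm_eq_abs, ← Complex.norm_real, hkey, norm_neg]
    refine intervalIntegral.norm_integral_le_of_norm_le Real.pi_pos.le
      (Filter.Eventually.of_forall fun θ _ => ?_)
      (((hsq.add hsq').div_const 2).intervalIntegrable _ _)
    have hconj : conj (Complex.exp (θ * Complex.I)) = Complex.exp ((-θ : ℝ) * Complex.I) := by
      rw [← Complex.exp_conj]
      simp
    rw [norm_mul, norm_mul (Complex.exp _), Complex.norm_exp_ofReal_mul_I, Complex.norm_I, hh]
    simp only [norm_mul, RCLike.norm_conj, hconj]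
    nlinarith [sq_nonneg (‖G (Complex.exp (θ * Complex.I))‖ -
      ‖G (Complex.exp ((-θ : ℝ) * Complex.I))‖)]
  refine hle.trans (le_of_eq ?_)
  rw [intervalIntegral.integral_div, intervalIntegral.integral_add
    (hsq.intervalIntegrable _ _) (hsq'.intervalIntegrable _ _),
    intervalIntegral.integral_comp_neg (fun θ : ℝ => ‖G (Complex.exp (θ * Complex.I))‖ ^ 2),
    neg_zero, add_comm, intervalIntegral.integral_add_adjacent_intervals
    (hsq.intervalIntegrable _ _) (hsq.intervalIntegrable _ _)]
  ring

lemma lintegral_enorm_sq_Ioo {E : Type*} [NormedAddCommGroup E] {a b : ℝ} (hab : a ≤ b)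
    {F : ℝ → E} (hF : ContinuousOn F (Set.Icc a b)) :
    ∫⁻ x in Set.Ioo a b, ‖F x‖ₑ ^ 2 = ENNReal.ofReal (∫ x in a..b, ‖F x‖ ^ 2) := by
  have hi : IntegrableOn (fun x => ‖F x‖ ^ 2) (Set.Ioo a b) :=
    ((hF.norm.pow 2).integrableOn_compact isCompact_Icc).mono_set Set.Ioo_subset_Icc_self
  rw [intervalIntegral.integral_of_le hab, integral_Ioc_eq_integral_Ioo,
    ofReal_integral_eq_lintegral_ofReal hi (Filter.Eventually.of_forall fun x => by positivity)]
  refine lintegral_congr fun x => ?_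
  rw [ENNReal.ofReal_pow (norm_nonneg _), ofReal_norm]

/-- The Fejér–Riesz inequality on the segment `[-t ξ, t ξ]`, with the quadratic mean taken over the
circle of radius `t ≥ t ‖ξ‖`. -/
lemma lintegral_segment_le {g : ℂ → ℂ} (hg : DifferentiableOn ℂ g (Metric.ball 0 1)) {ξ : ℂ}
    (hξ : ‖ξ‖ ≤ 1) {t : ℝ} (ht0 : 0 < t) (ht1 : t < 1) :
    ∫⁻ x in Set.Ioo (-t) t, ‖g (ξ * x)‖ₑ ^ 2 ≤
      ENNReal.ofReal (t / 2) *
        ∫⁻ θ in Set.Ioo (-π) π, ‖g (t * Complex.exp (θ * Complex.I))‖ₑ ^ 2 := by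
  have hR : 1 < t⁻¹ := (one_lt_inv₀ ht0).2 ht1
  have hscale : ∀ c : ℂ, ‖c‖ ≤ t →
      DifferentiableOn ℂ (fun z => g (c * z)) (Metric.ball 0 t⁻¹) := by
    intro c hc
    refine hg.comp (by fun_prop) fun z hz => ?_
    rw [mem_ball_zero_iff] at hz ⊢
    rw [norm_mul]
    calc ‖c‖ * ‖z‖ ≤ t * ‖z‖ := by gcongr
      _ < t * t⁻¹ := by gcongr
      _ = 1 := mul_inv_cancel₀ ht0.ne'
  have htnorm : ‖(t : ℂ)‖ = t := by simp [abs_of_pos ht0]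
  have hG1 := hscale t htnorm.le
  have hG2 := hscale (t * ξ) (by rw [norm_mul, htnorm]; nlinarith [norm_nonneg ξ])
  have h1 := fejer_riesz hR hG2
  have h2 := integral_normSq_circle_le hR hG1 hξ
  have hseg : ∫ x in (-t)..t, ‖g (ξ * x)‖ ^ 2 = t * ∫ x in (-1 : ℝ)..1, ‖g (t * ξ * x)‖ ^ 2 := by
    have := intervalIntegral.integral_comp_mul_left (a := -1) (b := 1)
      (fun x : ℝ => ‖g (ξ * x)‖ ^ 2) ht0.ne'
    have h3 : ∀ x : ℝ, (t : ℂ) * ξ * x = ξ * ((t * x : ℝ) : ℂ) := fun x => by push_cast; ring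
    simp only [h3]
    rw [this, smul_eq_mul, mul_one, mul_neg, mul_one, mul_inv_cancel_left₀ ht0.ne']
  have hcs : ContinuousOn (fun x : ℝ => g (ξ * x)) (Set.Icc (-t) t) := by
    refine hg.continuousOn.comp (by fun_prop) fun x hx => ?_
    rw [mem_ball_zero_iff, norm_mul, Complex.norm_real, Real.norm_eq_abs]
    have := abs_le.2 hx
    nlinarith [norm_nonneg ξ, abs_nonneg x]
  have hcc : Continuous fun θ : ℝ => g (t * Complex.exp (θ * Complex.I)) :=
    hg.continuousOn.comp_continuous (by fun_prop) fun θ => by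
      simpa [Complex.norm_exp_ofReal_mul_I, abs_of_pos ht0] using ht1
  rw [lintegral_enorm_sq_Ioo (by linarith) hcs,
    lintegral_enorm_sq_Ioo (by linarith [Real.pi_pos]) hcc.continuousOn,
    ← ENNReal.ofReal_mul (by positivity)]
  apply ENNReal.ofReal_le_ofReal
  rw [hseg]
  have h4 : ∀ θ : ℝ, (t : ℂ) * ξ * Complex.exp (θ * Complex.I) =
      t * (ξ * Complex.exp (θ * Complex.I)) := fun θ => mul_assoc _ _ _
  simp only [h4] at h1
  calc _ ≤ t * (1 / 2 * ∫ θ in (-π)..π, ‖g (t * Complex.exp (θ * Complex.I))‖ ^ 2) := by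
        gcongr
        exact h1.trans (by gcongr)
    _ = _ := by ring

/-! ### Area integrals -/

lemma lintegral_ball_eq_polar {F : ℂ → ℝ≥0∞} (hF : Measurable F) (r : ℝ) :
    ∫⁻ z in Metric.ball (0 : ℂ) r, F z =
      ∫⁻ s in Set.Ioo 0 r, ENNReal.ofReal s *
        ∫⁻ θ in Set.Ioo (-π) π, F (s * Complex.exp (θ * Complex.I)) := by
  have hF' : Measurable ((Metric.ball (0 : ℂ) r).indicator F) :=
    hF.indicator Metric.isOpen_ball.measurableSet
  have hm : Measurable fun p : ℝ × ℝ => ENNReal.ofReal p.1 *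
      (Metric.ball (0 : ℂ) r).indicator F (p.1 * Complex.exp (p.2 * Complex.I)) :=
    (by fun_prop : Measurable fun p : ℝ × ℝ => ENNReal.ofReal p.1).mul
      (hF'.comp (by fun_prop))
  rw [← lintegral_indicator Metric.isOpen_ball.measurableSet,
    ← Complex.lintegral_comp_polarCoord_symm]
  have hpol : ∀ p : ℝ × ℝ, Complex.polarCoord.symm p = p.1 * Complex.exp (p.2 * Complex.I) := by
    intro p
    rw [Complex.polarCoord_symm_apply, Complex.exp_mul_I, Complex.ofReal_cos, Complex.ofReal_sin]
  simp only [hpol, smul_eq_mul]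
  rw [polarCoord_target, Measure.volume_eq_prod, setLIntegral_prod _ hm.aemeasurable]
  rw [← lintegral_indicator measurableSet_Ioi, ← lintegral_indicator measurableSet_Ioo]
  refine lintegral_congr fun s => ?_
  by_cases hs : 0 < s
  · have hms : Measurable fun θ : ℝ =>
        (Metric.ball (0 : ℂ) r).indicator F (s * Complex.exp (θ * Complex.I)) :=
      hF'.comp (by fun_prop)
    rw [Set.indicator_of_mem (Set.mem_Ioi.2 hs)]
    simp only
    rw [lintegral_const_mul _ hms]
    have hmem : ∀ θ : ℝ, (s * Complex.exp (θ * Complex.I) ∈ Metric.ball (0 : ℂ) r) ↔ s < r := by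
      intro θ
      simp [Complex.norm_exp_ofReal_mul_I, abs_of_pos hs]
    by_cases hsr : s < r
    · rw [Set.indicator_of_mem (Set.mem_Ioo.2 ⟨hs, hsr⟩)]
      simp only [Set.indicator_of_mem ((hmem _).2 hsr)]
    · rw [Set.indicator_of_notMem (fun h => hsr h.2)]
      simp only [Set.indicator_of_notMem (fun h => hsr ((hmem _).1 h)), lintegral_zero, mul_zero]
  · rw [Set.indicator_of_notMem (by simpa using hs),
      Set.indicator_of_notMem (fun h => hs h.1)]

/-- The case of radius `0` in the monotonicity of quadratic means. -/
lemma enorm_sq_le_lintegral_circle {f : ℂ → ℂ} {s r : ℝ} (hs : 0 < s) (hsr : s < r)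
    (hf : DifferentiableOn ℂ f (Metric.ball 0 r)) :
    ENNReal.ofReal (2 * π) * ‖f 0‖ₑ ^ 2 ≤
      ∫⁻ θ in Set.Ioo (-π) π, ‖f (s * Complex.exp (θ * Complex.I))‖ₑ ^ 2 := by
  have hR : 1 < r / s := (one_lt_div hs).2 hsr
  have hG : DifferentiableOn ℂ (fun z => f (s * z)) (Metric.ball 0 (r / s)) := by
    refine hf.comp (by fun_prop) fun z hz => ?_
    rw [mem_ball_zero_iff] at hz ⊢
    rw [norm_mul, Complex.norm_real, Real.norm_of_nonneg hs.le, mul_comm]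
    exact (lt_div_iff₀ hs).1 hz
  have h := integral_normSq_circle_le hR hG (ξ := 0) (by simp)
  have hc : Continuous fun θ : ℝ => f (s * Complex.exp (θ * Complex.I)) := by
    simpa using continuous_comp_circle hR hG (w := 1) (by simp)
  rw [lintegral_enorm_sq_Ioo (by linarith [Real.pi_pos]) hc.continuousOn, ← ofReal_norm,
    ← ENNReal.ofReal_pow (norm_nonneg _), ← ENNReal.ofReal_mul (by positivity)]
  apply ENNReal.ofReal_le_ofReal
  refine le_trans (le_of_eq ?_) h
  simp only [zero_mul, mul_zero, intervalIntegral.integral_const, smul_eq_mul]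
  ring

lemma lintegral_ball_add (F : ℂ → ℝ≥0∞) (z : ℂ) (r : ℝ) :
    ∫⁻ w in Metric.ball (0 : ℂ) r, F (z + w) = ∫⁻ w in Metric.ball z r, F w := by
  rw [← lintegral_indicator Metric.isOpen_ball.measurableSet,
    ← lintegral_indicator Metric.isOpen_ball.measurableSet,
    ← lintegral_add_left_eq_self ((Metric.ball z r).indicator F) z]
  refine lintegral_congr fun w => ?_
  simp [Set.indicator, dist_eq_norm]

lemma lintegral_Ioo_ofReal {r : ℝ} (hr : 0 ≤ r) :
    ∫⁻ s in Set.Ioo 0 r, ENNReal.ofReal s = ENNReal.ofReal (r ^ 2 / 2) := by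
  rw [← ofReal_integral_eq_lintegral_ofReal, ← integral_Ioc_eq_integral_Ioo,
    ← intervalIntegral.integral_of_le hr, integral_id]
  · simp
  · exact (continuous_id.integrableOn_Icc).mono_set Set.Ioo_subset_Icc_self
  · exact (ae_restrict_mem measurableSet_Ioo).mono fun s hs => hs.1.le

/-- Sub-mean value property over discs. -/
lemma enorm_sq_mul_area_le {f : ℂ → ℂ} {z : ℂ} {r : ℝ} (hr : 0 < r)
    (hf : DifferentiableOn ℂ f (Metric.ball z r)) :
    ENNReal.ofReal (π * r ^ 2) * ‖f z‖ₑ ^ 2 ≤ ∫⁻ w in Metric.ball z r, ‖f w‖ₑ ^ 2 := by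
  set F : ℂ → ℂ := (Metric.ball z r).indicator f with hFdef
  have hFm : Measurable F := by
    classical
    rw [hFdef, ← Set.piecewise_eq_indicator]
    exact hf.continuousOn.measurable_piecewise continuousOn_const Metric.isOpen_ball.measurableSet
  have hmem : ∀ w, z + w ∈ Metric.ball z r ↔ w ∈ Metric.ball (0 : ℂ) r := fun w => by
    simp [dist_eq_norm]
  have hFd : DifferentiableOn ℂ (fun w => F (z + w)) (Metric.ball 0 r) := by
    refine DifferentiableOn.comp (t := Metric.ball z r)
      (hf.congr fun w hw => Set.indicator_of_mem hw _) (by fun_prop) fun w hw => (hmem w).2 hw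
  have hFz : F (z + 0) = f z := by
    rw [add_zero]
    exact Set.indicator_of_mem (Metric.mem_ball_self hr) _
  have htrans : ∫⁻ w in Metric.ball z r, ‖f w‖ₑ ^ 2 =
      ∫⁻ w in Metric.ball (0 : ℂ) r, ‖F (z + w)‖ₑ ^ 2 := by
    rw [lintegral_ball_add (fun w => ‖F w‖ₑ ^ 2)]
    refine setLIntegral_congr_fun Metric.isOpen_ball.measurableSet fun w hw => ?_
    simp only [hFdef, Set.indicator_of_mem hw]
  have hFm' : Measurable fun w => ‖F (z + w)‖ₑ ^ 2 := by fun_prop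
  have hcirc : ∀ s ∈ Set.Ioo 0 r, ENNReal.ofReal (2 * π) * ‖F (z + 0)‖ₑ ^ 2 ≤
      ∫⁻ θ in Set.Ioo (-π) π, ‖F (z + s * Complex.exp (θ * Complex.I))‖ₑ ^ 2 := fun s hs =>
    enorm_sq_le_lintegral_circle (f := fun w => F (z + w)) hs.1 hs.2 hFd
  clear_value F
  rw [htrans, lintegral_ball_eq_polar hFm', ← hFz]
  calc ENNReal.ofReal (π * r ^ 2) * ‖F (z + 0)‖ₑ ^ 2
      = ∫⁻ s in Set.Ioo 0 r, ENNReal.ofReal s *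
          (ENNReal.ofReal (2 * π) * ‖F (z + 0)‖ₑ ^ 2) := by
        rw [lintegral_mul_const _ (by fun_prop), lintegral_Ioo_ofReal hr.le, ← mul_assoc,
          ← ENNReal.ofReal_mul (by positivity)]
        congr 2
        ring
    _ ≤ _ := setLIntegral_mono' measurableSet_Ioo fun s hs => by
        gcongr
        exact hcirc s hs

/-! ### Point evaluations -/

lemma isOpen_puncturedDisc : IsOpen puncturedDisc :=
  Metric.isOpen_ball.sdiff isClosed_singleton

lemma mem_puncturedDisc {z : ℂ} : z ∈ puncturedDisc ↔ ‖z‖ < 1 ∧ z ≠ 0 := by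
  simp [puncturedDisc]

/-- The density of `diskMeasure α β` with respect to area, as a real function. -/
def diskDensity (α β : ℝ) (z : ℂ) : ℝ :=
  (ProbabilityTheory.beta (α + 1) (β + 1))⁻¹ * π⁻¹ * (‖z‖ ^ (2 * β) * (1 - ‖z‖ ^ 2) ^ α)

@[fun_prop]
lemma measurable_diskDensity : Measurable (diskDensity α β) := by
  unfold diskDensity
  fun_prop

lemma beta_inv_pos (hα : -1 < α) (hβ : -1 < β) :
    0 < (ProbabilityTheory.beta (α + 1) (β + 1))⁻¹ :=
  inv_pos.2 (ProbabilityTheory.beta_pos (by linarith) (by linarith))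

lemma diskDensity_pos (hα : -1 < α) (hβ : -1 < β) {z : ℂ} (hz : z ∈ puncturedDisc) :
    0 < diskDensity α β z := by
  obtain ⟨h1, h0⟩ := mem_puncturedDisc.1 hz
  have h0' := norm_pos_iff.2 h0
  have hs : 0 < 1 - ‖z‖ ^ 2 := by nlinarith
  have := beta_inv_pos hα hβ
  have := Real.pi_pos
  unfold diskDensity
  positivity

lemma continuousOn_diskDensity : ContinuousOn (diskDensity α β) puncturedDisc := by
  refine continuousOn_const.mul (ContinuousOn.mul ?_ ?_)
  · refine continuous_norm.continuousOn.rpow_const fun z hz => Or.inl ?_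
    exact norm_ne_zero_iff.2 (mem_puncturedDisc.1 hz).2
  · refine ContinuousOn.rpow_const (by fun_prop) fun z hz => Or.inl ?_
    have h1 := (mem_puncturedDisc.1 hz).1
    nlinarith [norm_nonneg z]

lemma setLIntegral_diskMeasure {F : ℂ → ℝ≥0∞} (hF : Measurable F) {s : Set ℂ}
    (hs : MeasurableSet s) :
    ∫⁻ z in s, F z ∂(diskMeasure α β) =
      ∫⁻ z in s, ENNReal.ofReal (diskDensity α β z) * F z
        ∂(volume.restrict (Metric.ball (0 : ℂ) 1)) := by
  change ∫⁻ z in s, F z ∂((volume.restrict (Metric.ball (0 : ℂ) 1)).withDensity fun z =>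
    ENNReal.ofReal (diskDensity α β z)) = _
  rw [setLIntegral_withDensity_eq_setLIntegral_mul _ (by fun_prop) hF hs]
  rfl

lemma lintegral_diskMeasure {F : ℂ → ℝ≥0∞} (hF : Measurable F) :
    ∫⁻ z, F z ∂(diskMeasure α β) =
      ∫⁻ z in Metric.ball (0 : ℂ) 1, ENNReal.ofReal (diskDensity α β z) * F z := by
  simpa using setLIntegral_diskMeasure (α := α) (β := β) hF MeasurableSet.univ

namespace BergmanSpace

lemma differentiableOn (f : BergmanSpace hα hβ) : DifferentiableOn ℂ f puncturedDisc := f.2.1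

lemma eq_zero_of_notMem (f : BergmanSpace hα hβ) {z : ℂ} (hz : z ∉ puncturedDisc) : f z = 0 :=
  f.2.2.1 z hz

@[fun_prop]
lemma measurable (f : BergmanSpace hα hβ) : Measurable (f : ℂ → ℂ) := by
  classical
  have : (f : ℂ → ℂ) = puncturedDisc.piecewise f 0 := by
    funext z
    by_cases hz : z ∈ puncturedDisc
    · rw [Set.piecewise_eq_of_mem _ _ _ hz]
    · rw [Set.piecewise_eq_of_notMem _ _ _ hz, f.eq_zero_of_notMem hz, Pi.zero_apply]
  rw [this]
  exact f.differentiableOn.continuousOn.measurable_piecewise continuousOn_const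
    isOpen_puncturedDisc.measurableSet

lemma add_apply (f g : BergmanSpace hα hβ) (z : ℂ) : (f + g) z = f z + g z := rfl

lemma sub_apply (f g : BergmanSpace hα hβ) (z : ℂ) : (f - g) z = f z - g z := rfl

lemma smul_apply (c : ℂ) (f : BergmanSpace hα hβ) (z : ℂ) : (c • f) z = c * f z := rfl

lemma norm_toL2 (f : BergmanSpace hα hβ) : ‖toL2 f‖ = ‖f‖ := rfl

lemma enorm_sq_eq_lintegral (f : BergmanSpace hα hβ) :
    ‖f‖ₑ ^ 2 = ∫⁻ z, ‖f z‖ₑ ^ 2 ∂(diskMeasure α β) := by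
  have h1 : ‖f‖ₑ = eLpNorm f 2 (diskMeasure α β) := by
    rw [← ofReal_norm, ← norm_toL2, ofReal_norm]
    exact Lp.enorm_toLp f.2.2.2
  have h2 := eLpNorm_nnreal_pow_eq_lintegral (f := (f : ℂ → ℂ)) (μ := diskMeasure α β)
    (p := 2) two_ne_zero
  rw [h1]
  simpa using h2

/-- A weighted sub-mean value inequality on discs where the density is bounded below. -/
lemma enorm_sq_mul_le_setLIntegral (f : BergmanSpace hα hβ) {w : ℂ} {r δ : ℝ} (hr : 0 < r)
    (hδ : 0 ≤ δ) (hsub : Metric.ball w r ⊆ puncturedDisc)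
    (hdens : ∀ z ∈ Metric.ball w r, δ ≤ diskDensity α β z) :
    ENNReal.ofReal (δ * (π * r ^ 2)) * ‖f w‖ₑ ^ 2 ≤
      ∫⁻ z in Metric.ball w r, ‖f z‖ₑ ^ 2 ∂(diskMeasure α β) := by
  have hsub' : Metric.ball w r ⊆ Metric.ball 0 1 := hsub.trans Set.sdiff_subset
  rw [setLIntegral_diskMeasure (by fun_prop) Metric.isOpen_ball.measurableSet,
    Measure.restrict_restrict_of_subset hsub', ENNReal.ofReal_mul hδ, mul_assoc]
  calc _ ≤ ENNReal.ofReal δ * ∫⁻ z in Metric.ball w r, ‖f z‖ₑ ^ 2 := by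
        gcongr
        exact enorm_sq_mul_area_le hr (f.differentiableOn.mono hsub)
    _ = ∫⁻ z in Metric.ball w r, ENNReal.ofReal δ * ‖f z‖ₑ ^ 2 :=
        (lintegral_const_mul _ (by fun_prop)).symm
    _ ≤ _ := setLIntegral_mono' Metric.isOpen_ball.measurableSet fun z hz => by
        gcongr
        exact hdens z hz

/-- Point evaluations are bounded, locally uniformly in the point. -/
lemma exists_norm_apply_le (hα : -1 < α) (hβ : -1 < β) {z : ℂ} (hz : z ∈ puncturedDisc) :
    ∃ r > 0, ∃ C, ∀ f : BergmanSpace hα hβ, ∀ w ∈ Metric.ball z r, ‖f w‖ ≤ C * ‖f‖ := by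
  obtain ⟨R, hR, hRsub⟩ := Metric.nhds_basis_closedBall.mem_iff.1 (isOpen_puncturedDisc.mem_nhds hz)
  obtain ⟨x, hx, hmin⟩ := (isCompact_closedBall z R).exists_isMinOn
    ⟨z, Metric.mem_closedBall_self hR.le⟩ ((continuousOn_diskDensity (α := α) (β := β)).mono hRsub)
  set δ := diskDensity α β x with hδ
  have hδ0 : 0 < δ := diskDensity_pos hα hβ (hRsub hx)
  have hc : 0 < δ * (π * (R / 2) ^ 2) := by positivity
  refine ⟨R / 2, by positivity, √((δ * (π * (R / 2) ^ 2))⁻¹), fun f w hw => ?_⟩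
  have hball : Metric.ball w (R / 2) ⊆ Metric.closedBall z R := by
    intro y hy
    rw [Metric.mem_ball] at hw hy
    rw [Metric.mem_closedBall]
    linarith [dist_triangle y w z]
  have h1 := (f.enorm_sq_mul_le_setLIntegral (r := R / 2) (by positivity) hδ0.le
    (hball.trans hRsub) (fun y hy => hmin (hball hy))).trans (setLIntegral_le_lintegral _ _)
  rw [← enorm_sq_eq_lintegral, ← ofReal_norm, ← ofReal_norm, ← ENNReal.ofReal_pow (norm_nonneg _),
    ← ENNReal.ofReal_pow (norm_nonneg _), ← ENNReal.ofReal_mul hc.le,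
    ENNReal.ofReal_le_ofReal_iff (by positivity)] at h1
  rw [← Real.sqrt_sq (norm_nonneg f), ← Real.sqrt_mul (by positivity)]
  apply Real.le_sqrt_of_sq_le
  rw [inv_mul_eq_div, le_div_iff₀ hc]
  linarith

lemma exists_uniformCauchySeqOn_ball {u : ℕ → BergmanSpace hα hβ} (hu : CauchySeq u) {z : ℂ}
    (hz : z ∈ puncturedDisc) :
    ∃ r > 0, UniformCauchySeqOn (fun n => (u n : ℂ → ℂ)) .atTop (Metric.ball z r) := by
  obtain ⟨r, hr, C, hC⟩ := exists_norm_apply_le hα hβ hz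
  refine ⟨r, hr, Metric.uniformCauchySeqOn_iff.2 fun ε hε => ?_⟩
  obtain ⟨N, hN⟩ := Metric.cauchySeq_iff.1 hu (ε / (|C| + 1)) (by positivity)
  refine ⟨N, fun m hm n hn w hw => ?_⟩
  rw [dist_eq_norm, ← sub_apply]
  calc ‖(u m - u n) w‖ ≤ C * ‖u m - u n‖ := hC _ w hw
    _ ≤ (|C| + 1) * ‖u m - u n‖ := by
        gcongr
        linarith [le_abs_self C]
    _ < (|C| + 1) * (ε / (|C| + 1)) := by
        gcongr
        rw [← dist_eq_norm]
        exact hN m hm n hn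
    _ = ε := by field_simp

/-- The Bergman space is complete: an `L²`-Cauchy sequence converges locally uniformly on the
punctured disc, to a holomorphic function which agrees almost everywhere with the `L²`-limit. -/
instance : CompleteSpace (BergmanSpace hα hβ) := by
  refine Metric.complete_of_cauchySeq_tendsto fun u hu => ?_
  have hlim : ∀ z, ∃ l, Filter.Tendsto (fun n => u n z) .atTop (nhds l) := by
    intro z
    by_cases hz : z ∈ puncturedDisc
    · obtain ⟨r, hr, hC⟩ := exists_uniformCauchySeqOn_ball hu hz
      exact cauchySeq_tendsto_of_complete (hC.cauchySeq (Metric.mem_ball_self hr))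
    · refine ⟨0, ?_⟩
      simp only [eq_zero_of_notMem _ hz]
      exact tendsto_const_nhds
  choose F hF using hlim
  have hFu : TendstoLocallyUniformlyOn (fun n => (u n : ℂ → ℂ)) F .atTop puncturedDisc := by
    refine tendstoLocallyUniformlyOn_of_forall_exists_nhds fun z hz => ?_
    obtain ⟨r, hr, hC⟩ := exists_uniformCauchySeqOn_ball hu hz
    exact ⟨Metric.ball z r, mem_nhdsWithin_of_mem_nhds (Metric.ball_mem_nhds z hr),
      hC.tendstoUniformlyOn_of_tendsto fun w _ => hF w⟩
  have hFd : DifferentiableOn ℂ F puncturedDisc :=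
    hFu.differentiableOn (Filter.Eventually.of_forall fun n => (u n).differentiableOn)
      isOpen_puncturedDisc
  have hF0 : ∀ z ∉ puncturedDisc, F z = 0 := fun z hz =>
    tendsto_nhds_unique (hF z) (by
      simp only [eq_zero_of_notMem _ hz]
      exact tendsto_const_nhds)
  have hdist : ∀ f g : BergmanSpace hα hβ, dist (toL2 f) (toL2 g) = dist f g := fun f g => by
    rw [dist_eq_norm, dist_eq_norm, ← map_sub, norm_toL2]
  have huL : CauchySeq fun n => toL2 (u n) := by
    rw [Metric.cauchySeq_iff] at hu ⊢
    simpa only [hdist] using hu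
  obtain ⟨G, hG⟩ := cauchySeq_tendsto_of_complete huL
  obtain ⟨ns, hns, hae⟩ := (tendstoInMeasure_of_tendsto_Lp hG).exists_seq_tendsto_ae
  have hcoe : ∀ᵐ z ∂(diskMeasure α β), ∀ n, toL2 (u n) z = u n z :=
    ae_all_iff.2 fun n => (u n).2.2.2.coeFn_toLp
  have hFG : F =ᵐ[diskMeasure α β] G := by
    filter_upwards [hae, hcoe] with z hz hc
    simp only [hc] at hz
    exact tendsto_nhds_unique ((hF z).comp hns.tendsto_atTop) hz
  have hFm : MemLp F 2 (diskMeasure α β) := (memLp_congr_ae hFG).2 (Lp.memLp G)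
  let f : BergmanSpace hα hβ := ⟨F, hFd, hF0, hFm⟩
  have hfG : toL2 f = G := Lp.ext (hFm.coeFn_toLp.trans hFG)
  refine ⟨f, tendsto_iff_dist_tendsto_zero.2 ?_⟩
  simp only [← hdist, hfG]
  exact tendsto_iff_dist_tendsto_zero.1 hG

end BergmanSpace

/-- Riesz representation of the point evaluations. -/
lemma exists_inner_eq_apply (hα : -1 < α) (hβ : -1 < β) {z : ℂ} (hz : z ∈ puncturedDisc) :
    ∃ k : BergmanSpace hα hβ, ∀ f : BergmanSpace hα hβ, inner ℂ k f = f z := by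
  obtain ⟨r, hr, C, hC⟩ := BergmanSpace.exists_norm_apply_le hα hβ hz
  let ev : BergmanSpace hα hβ →ₗ[ℂ] ℂ :=
    { toFun := fun f => f z
      map_add' := fun f g => BergmanSpace.add_apply f g z
      map_smul' := fun c f => BergmanSpace.smul_apply c f z }
  refine ⟨(InnerProductSpace.toDual ℂ _).symm
    (ev.mkContinuous C fun f => hC f z (Metric.mem_ball_self hr)), fun f => ?_⟩
  rw [InnerProductSpace.toDual_symm_apply]
  rfl

/-- The element of the Bergman space that represents the evaluation at `z`; it is `0` outside the
punctured disc. -/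
def evalRepr (hα : -1 < α) (hβ : -1 < β) (z : ℂ) : BergmanSpace hα hβ := by
  classical
  exact if h : ∃ k : BergmanSpace hα hβ, ∀ f : BergmanSpace hα hβ, inner ℂ k f = f z
    then h.choose else 0

lemma inner_evalRepr {z : ℂ} (hz : z ∈ puncturedDisc) (f : BergmanSpace hα hβ) :
    inner ℂ (evalRepr hα hβ z) f = f z := by
  rw [evalRepr, dif_pos (exists_inner_eq_apply hα hβ hz)]
  exact (exists_inner_eq_apply hα hβ hz).choose_spec f

lemma bergmanKernel_eq_evalRepr {z : ℂ} (hz : z ∈ puncturedDisc) (w : ℂ) :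
    bergmanKernel hα hβ w z = evalRepr hα hβ z w := by
  rw [bergmanKernel, evalRepr, dif_pos (exists_inner_eq_apply hα hβ hz),
    dif_pos (exists_inner_eq_apply hα hβ hz)]

lemma isReproducingKernel_bergmanKernel (hα : -1 < α) (hβ : -1 < β) :
    IsReproducingKernel hα hβ (bergmanKernel hα hβ) := fun z hz =>
  ⟨evalRepr hα hβ z, fun w _ => (bergmanKernel_eq_evalRepr hz w).symm, inner_evalRepr hz⟩

lemma bergmanKernel_conj_symm {z w : ℂ} (hz : z ∈ puncturedDisc) (hw : w ∈ puncturedDisc) :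
    bergmanKernel hα hβ z w = conj (evalRepr hα hβ z w) := by
  rw [bergmanKernel_eq_evalRepr hw, ← inner_evalRepr hz, ← inner_evalRepr hw, inner_conj_symm]

/-! ### The pole at the origin -/

lemma exists_maxPoleOrder_eq (hβ : -1 < β) : ∃ n : ℕ, maxPoleOrder 2 β = n ∧ β ≤ n := by
  have h2 : 2 * (β + 1) / 2 = β + 1 := by ring
  unfold maxPoleOrder
  rw [h2]
  split_ifs with h
  · obtain ⟨n, hn⟩ := h
    have hn0 : n ≠ 0 := by
      rintro rfl
      push_cast at hn
      linarith
    obtain ⟨k, rfl⟩ := Nat.exists_eq_succ_of_ne_zero hn0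
    refine ⟨k, ?_, ?_⟩
    · rw [hn]
      simp
    · push_cast at hn
      linarith
  · have h0 : 0 ≤ ⌊β + 1⌋ := Int.floor_nonneg.2 (by linarith)
    obtain ⟨k, hk⟩ := Int.eq_ofNat_of_zero_le h0
    refine ⟨k, hk, ?_⟩
    have := Int.lt_floor_add_one (β + 1)
    rw [hk] at this
    push_cast at this
    linarith

/-- On the disc of radius `‖z‖ / 2` about `z` the density is comparable to `‖z‖ ^ (2 * β)`. -/
lemma exists_mul_rpow_le_diskDensity (hα : -1 < α) (hβ : -1 < β) :
    ∃ κ > 0, ∀ z : ℂ, z ≠ 0 → ‖z‖ < 1 / 2 → ∀ w ∈ Metric.ball z (‖z‖ / 2),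
      κ * ‖z‖ ^ (2 * β) ≤ diskDensity α β w := by
  have hne : ∀ a ∈ Set.Icc (1 / 2 : ℝ) (3 / 2), a ≠ 0 := fun a ha => by
    have : 0 < a := by linarith [ha.1]
    exact this.ne'
  have hne' : ∀ s ∈ Set.Icc (0 : ℝ) (3 / 4), 1 - s ^ 2 ≠ 0 := fun s hs => by
    have : 0 < 1 - s ^ 2 := by nlinarith [hs.1, hs.2]
    exact this.ne'
  obtain ⟨a, ha, hamin⟩ := isCompact_Icc.exists_isMinOn
    ⟨1, show (1 : ℝ) ∈ Set.Icc (1 / 2 : ℝ) (3 / 2) by norm_num⟩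
    (continuousOn_id.rpow_const (p := 2 * β) fun a ha => Or.inl (hne a ha))
  obtain ⟨s, hs, hsmin⟩ := isCompact_Icc.exists_isMinOn
    ⟨0, show (0 : ℝ) ∈ Set.Icc (0 : ℝ) (3 / 4) by norm_num⟩
    (ContinuousOn.rpow_const (f := fun s : ℝ => 1 - s ^ 2) (p := α) (by fun_prop)
      fun s hs => Or.inl (hne' s hs))
  have hapos : 0 < a ^ (2 * β) := Real.rpow_pos_of_pos (by linarith [ha.1]) _
  have hspos : 0 < (1 - s ^ 2) ^ α :=
    Real.rpow_pos_of_pos (by nlinarith [hs.1, hs.2]) _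
  have hB := beta_inv_pos hα hβ
  have hpi := Real.pi_pos
  refine ⟨(ProbabilityTheory.beta (α + 1) (β + 1))⁻¹ * π⁻¹ * (a ^ (2 * β) * (1 - s ^ 2) ^ α),
    by positivity, fun z hz0 hz w hw => ?_⟩
  have hz0' : 0 < ‖z‖ := norm_pos_iff.2 hz0
  rw [Metric.mem_ball, dist_eq_norm] at hw
  have h1 : ‖w‖ ≤ ‖z‖ + ‖w - z‖ := norm_le_norm_add_norm_sub' w z
  have h2 : ‖z‖ ≤ ‖w‖ + ‖w - z‖ := by
    rw [norm_sub_rev]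
    exact norm_le_norm_add_norm_sub' z w
  have hq : ‖w‖ / ‖z‖ ∈ Set.Icc (1 / 2 : ℝ) (3 / 2) := by
    constructor
    · rw [le_div_iff₀ hz0']
      linarith
    · rw [div_le_iff₀ hz0']
      linarith
  have hA : a ^ (2 * β) ≤ (‖w‖ / ‖z‖) ^ (2 * β) := hamin hq
  have hS : (1 - s ^ 2) ^ α ≤ (1 - ‖w‖ ^ 2) ^ α :=
    hsmin (show ‖w‖ ∈ Set.Icc (0 : ℝ) (3 / 4) from ⟨norm_nonneg w, by linarith⟩)
  have hsplit : ‖w‖ ^ (2 * β) = (‖w‖ / ‖z‖) ^ (2 * β) * ‖z‖ ^ (2 * β) := by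
    rw [← Real.mul_rpow (by positivity) hz0'.le, div_mul_cancel₀ _ hz0'.ne']
  unfold diskDensity
  rw [hsplit]
  calc _ = (ProbabilityTheory.beta (α + 1) (β + 1))⁻¹ * π⁻¹ *
        (a ^ (2 * β) * ‖z‖ ^ (2 * β) * (1 - s ^ 2) ^ α) := by ring
    _ ≤ _ := by gcongr

namespace BergmanSpace

/-- Absolute continuity of the integral of `‖f‖²`, on discs shrinking to the origin. -/
lemma tendsto_setLIntegral_ball_zero (f : BergmanSpace hα hβ) :
    Filter.Tendsto (fun z : ℂ => ∫⁻ w in Metric.ball (0 : ℂ) (2 * ‖z‖), ‖f w‖ₑ ^ 2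
      ∂(diskMeasure α β)) (nhds 0) (nhds 0) := by
  have hfin : ∫⁻ z in Metric.ball (0 : ℂ) 1,
      ENNReal.ofReal (diskDensity α β z) * ‖f z‖ₑ ^ 2 ≠ ∞ := by
    rw [← lintegral_diskMeasure (by fun_prop), ← enorm_sq_eq_lintegral]
    finiteness
  have hvol : Filter.Tendsto (fun z : ℂ => volume.restrict (Metric.ball (0 : ℂ) 1)
      (Metric.ball (0 : ℂ) (2 * ‖z‖))) (nhds 0) (nhds 0) := by
    refine tendsto_of_tendsto_of_tendsto_of_le_of_le tendsto_const_nhds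
      (h := fun z : ℂ => ENNReal.ofReal (2 * ‖z‖) ^ 2 * NNReal.pi) ?_ (fun _ => zero_le)
      (fun z => (Measure.restrict_apply_le _ _).trans_eq (Complex.volume_ball _ _))
    have h : Continuous fun z : ℂ => ENNReal.ofReal (2 * ‖z‖) ^ 2 * NNReal.pi := by
      have h2 : Continuous fun z : ℂ => ENNReal.ofReal (2 * ‖z‖) ^ 2 :=
        (ENNReal.continuous_pow 2).comp (ENNReal.continuous_ofReal.comp (by fun_prop))
      exact (ENNReal.continuous_mul_const (by finiteness)).comp h2
    simpa using h.tendsto 0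
  refine (tendsto_setLIntegral_zero hfin hvol).congr fun z => ?_
  rw [setLIntegral_diskMeasure (by fun_prop) Metric.isOpen_ball.measurableSet]

/-- The growth of a square integrable function at the origin. The `o`, rather than `O`, is what
excludes a pole of order `β + 1` when `β` is an integer. -/
lemma tendsto_rpow_mul_norm (f : BergmanSpace hα hβ) :
    Filter.Tendsto (fun z : ℂ => ‖z‖ ^ (β + 1) * ‖f z‖) (nhdsWithin 0 {0}ᶜ) (nhds 0) := by
  obtain ⟨κ, hκ, hdens⟩ := exists_mul_rpow_le_diskDensity hα hβ
  have hpi := Real.pi_pos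
  have hc : 0 < κ * (π / 4) := by positivity
  have hsmall : ∀ᶠ z : ℂ in nhdsWithin 0 {0}ᶜ, z ≠ 0 ∧ ‖z‖ < 1 / 2 := by
    refine Filter.Eventually.and self_mem_nhdsWithin (mem_nhdsWithin_of_mem_nhds ?_)
    filter_upwards [Metric.ball_mem_nhds (0 : ℂ) (by norm_num : (0 : ℝ) < 1 / 2)] with z hz
    simpa using hz
  have hle : ∀ᶠ z : ℂ in nhdsWithin 0 {0}ᶜ,
      ENNReal.ofReal (κ * (π / 4) * (‖z‖ ^ (β + 1) * ‖f z‖) ^ 2) ≤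
        ∫⁻ w in Metric.ball (0 : ℂ) (2 * ‖z‖), ‖f w‖ₑ ^ 2 ∂(diskMeasure α β) := by
    filter_upwards [hsmall] with z hz
    obtain ⟨hz0, hz1⟩ := hz
    have hz0' : 0 < ‖z‖ := norm_pos_iff.2 hz0
    have hsub : Metric.ball z (‖z‖ / 2) ⊆ puncturedDisc := by
      intro w hw
      rw [Metric.mem_ball, dist_eq_norm] at hw
      refine mem_puncturedDisc.2 ⟨?_, ?_⟩
      · linarith [norm_le_norm_add_norm_sub' w z]
      · rintro rfl
        rw [zero_sub, norm_neg] at hw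
        linarith
    have hsub' : Metric.ball z (‖z‖ / 2) ⊆ Metric.ball 0 (2 * ‖z‖) := by
      intro w hw
      rw [Metric.mem_ball, dist_eq_norm] at hw
      rw [mem_ball_zero_iff]
      linarith [norm_le_norm_add_norm_sub' w z]
    have h := f.enorm_sq_mul_le_setLIntegral (r := ‖z‖ / 2) (by positivity)
      (by positivity) hsub (hdens z hz0 hz1)
    refine le_trans (le_of_eq ?_) (h.trans (lintegral_mono_set hsub'))
    rw [← ofReal_norm, ← ENNReal.ofReal_pow (norm_nonneg _),
      ← ENNReal.ofReal_mul (by positivity)]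
    congr 1
    have hpow : ‖z‖ ^ (2 * β) * ‖z‖ ^ 2 = (‖z‖ ^ (β + 1)) ^ 2 := by
      rw [← Real.rpow_natCast, ← Real.rpow_natCast, ← Real.rpow_add hz0', ← Real.rpow_mul hz0'.le]
      congr 1
      push_cast
      ring
    rw [mul_pow, ← hpow]
    ring
  have h0 : Filter.Tendsto (fun z : ℂ =>
      ENNReal.ofReal (κ * (π / 4) * (‖z‖ ^ (β + 1) * ‖f z‖) ^ 2))
      (nhdsWithin 0 {0}ᶜ) (nhds 0) :=
    tendsto_of_tendsto_of_tendsto_of_le_of_le' tendsto_const_nhds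
      (f.tendsto_setLIntegral_ball_zero.mono_left nhdsWithin_le_nhds)
      (Filter.Eventually.of_forall fun _ => zero_le) hle
  have h1 := (ENNReal.tendsto_toReal ENNReal.zero_ne_top).comp h0
  have h2 : Filter.Tendsto (fun z : ℂ => κ * (π / 4) * (‖z‖ ^ (β + 1) * ‖f z‖) ^ 2)
      (nhdsWithin 0 {0}ᶜ) (nhds 0) := by
    refine Filter.Tendsto.congr (fun z => ?_) h1
    exact ENNReal.toReal_ofReal (by positivity)
  have h3 := (h2.const_mul (κ * (π / 4))⁻¹).sqrt
  rw [mul_zero, Real.sqrt_zero] at h3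
  refine h3.congr fun z => ?_
  rw [inv_mul_cancel_left₀ hc.ne', Real.sqrt_sq (by positivity)]

/-- Functions in the Bergman space have a pole of order at most `n` at the origin if `β ≤ n`. -/
lemma exists_holomorphic_eq_pow_mul (f : BergmanSpace hα hβ) {n : ℕ} (hn : β ≤ n) :
    ∃ g : ℂ → ℂ, DifferentiableOn ℂ g (Metric.ball 0 1) ∧
      ∀ z ∈ puncturedDisc, g z = z ^ n * f z := by
  set g : ℂ → ℂ := fun z => z ^ n * f z with hg
  have hg0 : g 0 = 0 := by
    simp [hg, f.eq_zero_of_notMem (z := 0) (fun h => h.2 rfl)]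
  have hd : DifferentiableOn ℂ g (Metric.ball 0 1 \ {0}) :=
    (differentiableOn_id.pow n).mul f.differentiableOn
  refine ⟨_, Complex.differentiableOn_update_limUnder_of_isLittleO
    (Metric.ball_mem_nhds 0 one_pos) hd ?_, fun z hz => Function.update_of_ne hz.2 _ _⟩
  simp only [hg0, sub_zero]
  refine (Asymptotics.isLittleO_iff_tendsto' ?_).2 ?_
  · filter_upwards [self_mem_nhdsWithin] with z hz h
    exact absurd (inv_eq_zero.1 h) hz
  · refine squeeze_zero_norm' ?_ f.tendsto_rpow_mul_norm
    filter_upwards [self_mem_nhdsWithin, mem_nhdsWithin_of_mem_nhds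
      (Metric.ball_mem_nhds (0 : ℂ) one_pos)] with z hz hz1
    have hz0 : 0 < ‖z‖ := norm_pos_iff.2 hz
    have hz1' : ‖z‖ < 1 := by simpa using hz1
    have hle : ‖z‖ ^ ((n : ℝ) + 1) ≤ ‖z‖ ^ (β + 1) :=
      Real.rpow_le_rpow_of_exponent_ge hz0 hz1'.le (by linarith)
    rw [Real.rpow_add_one hz0.ne', Real.rpow_natCast] at hle
    rw [div_inv_eq_mul, norm_mul, hg, norm_mul, norm_pow]
    calc _ = ‖z‖ ^ n * ‖z‖ * ‖f z‖ := by ring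
      _ ≤ _ := by gcongr

end BergmanSpace

/-! ### The weight -/

lemma measurable_intervalIntegral_left {h : ℝ → ℝ} (hh : Measurable h) (b : ℝ) :
    Measurable fun r => ∫ t in r..b, h t := by
  have h1 : ∀ A : Set (ℝ × ℝ), MeasurableSet A →
      Measurable fun r => ∫ t, A.indicator (fun p => h p.2) (r, t) := fun A hA =>
    (StronglyMeasurable.integral_prod_right' (ν := volume)
      (f := A.indicator (fun p : ℝ × ℝ => h p.2))
      ((hh.comp measurable_snd).indicator hA).stronglyMeasurable).measurable
  have hA : MeasurableSet {p : ℝ × ℝ | p.1 < p.2 ∧ p.2 ≤ b} :=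
    (measurableSet_lt measurable_fst measurable_snd).inter
      (measurableSet_le measurable_snd measurable_const)
  have hB : MeasurableSet {p : ℝ × ℝ | b < p.2 ∧ p.2 ≤ p.1} :=
    (measurableSet_lt measurable_const measurable_snd).inter
      (measurableSet_le measurable_snd measurable_fst)
  convert! (h1 _ hA).sub (h1 _ hB) using 1
  funext r
  rw [Pi.sub_apply, intervalIntegral, ← integral_indicator measurableSet_Ioc,
    ← integral_indicator measurableSet_Ioc]
  rfl

lemma measurable_weightJ (α β p : ℝ) : Measurable (weightJ α β p) := by
  unfold weightJ
  refine Measurable.mul (by fun_prop) (measurable_intervalIntegral_left ?_ 1)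
  fun_prop

lemma weightJ_nonneg (hα : -1 < α) (hβ : -1 < β) {p r : ℝ} (hr0 : 0 ≤ r) (hr1 : r ≤ 1) :
    0 ≤ weightJ α β p r := by
  unfold weightJ
  have hB : 0 < ProbabilityTheory.beta (α + 1) (β + 1) :=
    ProbabilityTheory.beta_pos (by linarith) (by linarith)
  refine mul_nonneg (by positivity) (intervalIntegral.integral_nonneg hr1 fun t ht => ?_)
  have ht0 : 0 ≤ t := hr0.trans ht.1
  have : 0 ≤ 1 - t ^ 2 := by nlinarith [ht.2]
  positivity

/-- The integrand in the definition of the weight `weightJ α β 2` when the order of the pole is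
`n`. -/
def radialWeight (α β : ℝ) (n : ℕ) (t : ℝ) : ℝ := t ^ (2 * β - 2 * n + 1) * (1 - t ^ 2) ^ α

@[fun_prop]
lemma measurable_radialWeight (n : ℕ) : Measurable (radialWeight α β n) := by
  unfold radialWeight
  fun_prop

/-- The inequality needs no integrability of the radial weight: without it the integral in
`weightJ` would be `0` by convention. -/
lemma ofReal_weightJ_le (hα : -1 < α) (hβ : -1 < β) {n : ℕ} (hn : maxPoleOrder 2 β = n) {r : ℝ}
    (hr0 : 0 < r) (hr1 : r < 1) :
    ENNReal.ofReal (weightJ α β 2 r) ≤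
      ENNReal.ofReal (2 * (ProbabilityTheory.beta (α + 1) (β + 1))⁻¹) *
        ENNReal.ofReal (r ^ (2 * n)) *
        ∫⁻ t in Set.Ioo r 1, ENNReal.ofReal (radialWeight α β n t) := by
  have hB := beta_inv_pos hα hβ
  have hpow : r ^ (2 * ((maxPoleOrder 2 β : ℤ) : ℝ)) = r ^ (2 * n) := by
    rw [hn, ← Real.rpow_natCast]
    push_cast
    rfl
  have hw : weightJ α β 2 r = 2 * (ProbabilityTheory.beta (α + 1) (β + 1))⁻¹ * r ^ (2 * n) *
      ∫ t in Set.Ioo r 1, radialWeight α β n t := by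
    unfold weightJ radialWeight
    rw [hpow, intervalIntegral.integral_of_le hr1.le, integral_Ioc_eq_integral_Ioo, hn]
    push_cast
    ring
  rw [hw, ENNReal.ofReal_mul (by positivity), ENNReal.ofReal_mul (by positivity)]
  gcongr
  rw [integral_eq_lintegral_of_nonneg_ae _ (by fun_prop)]
  · exact ENNReal.ofReal_toReal_le
  · refine (ae_restrict_mem measurableSet_Ioo).mono fun t ht => ?_
    have ht0 : 0 < t := hr0.trans ht.1
    have : 0 < 1 - t ^ 2 := by nlinarith [ht.2]
    unfold radialWeight
    positivity

/-! ### The restriction to a diameter -/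

namespace BergmanSpace

lemma lintegral_segment_le (f : BergmanSpace hα hβ) {n : ℕ} (hn : β ≤ n) {ξ : ℂ} (hξ0 : ξ ≠ 0)
    (hξ : ‖ξ‖ ≤ 1) {t : ℝ} (ht0 : 0 < t) (ht1 : t < 1) :
    ∫⁻ x in Set.Ioo (-t) t, ENNReal.ofReal (|x| ^ (2 * n)) * ‖f (ξ * x)‖ₑ ^ 2 ≤
      ENNReal.ofReal (‖ξ‖ ^ (-2 * (n : ℤ))) * (ENNReal.ofReal (t / 2 * t ^ (2 * n)) *
        ∫⁻ θ in Set.Ioo (-π) π, ‖f (t * Complex.exp (θ * Complex.I))‖ₑ ^ 2) := by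
  obtain ⟨g, hg, hgf⟩ := f.exists_holomorphic_eq_pow_mul hn
  have hξpos : 0 < ‖ξ‖ := norm_pos_iff.2 hξ0
  have hgf' : ∀ z ∈ puncturedDisc, ‖g z‖ₑ ^ 2 = ENNReal.ofReal (‖z‖ ^ (2 * n)) * ‖f z‖ₑ ^ 2 := by
    intro z hz
    rw [hgf z hz, enorm_mul, mul_pow, ← ofReal_norm (z ^ n), norm_pow,
      ← ENNReal.ofReal_pow (by positivity), ← pow_mul, mul_comm n 2]
  have hξn : ENNReal.ofReal (‖ξ‖ ^ (-2 * (n : ℤ))) * ENNReal.ofReal (‖ξ‖ ^ (2 * n)) = 1 := by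
    rw [← ENNReal.ofReal_mul (by positivity), ← zpow_natCast, ← zpow_add₀ hξpos.ne']
    simp
  calc ∫⁻ x in Set.Ioo (-t) t, ENNReal.ofReal (|x| ^ (2 * n)) * ‖f (ξ * x)‖ₑ ^ 2
      ≤ ∫⁻ x in Set.Ioo (-t) t, ENNReal.ofReal (‖ξ‖ ^ (-2 * (n : ℤ))) * ‖g (ξ * x)‖ₑ ^ 2 := by
        refine setLIntegral_mono' measurableSet_Ioo fun x hx => ?_
        by_cases hmem : ξ * x ∈ puncturedDisc
        · rw [hgf' _ hmem, norm_mul, mul_pow, ENNReal.ofReal_mul (by positivity), ← mul_assoc,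
            ← mul_assoc, hξn, one_mul, Complex.norm_real, Real.norm_eq_abs]
        · simp [f.eq_zero_of_notMem hmem]
    _ = ENNReal.ofReal (‖ξ‖ ^ (-2 * (n : ℤ))) * ∫⁻ x in Set.Ioo (-t) t, ‖g (ξ * x)‖ₑ ^ 2 :=
        lintegral_const_mul' _ _ ENNReal.ofReal_ne_top
    _ ≤ _ := by
        gcongr
        refine (MeromorphicBergman.lintegral_segment_le hg hξ ht0 ht1).trans (le_of_eq ?_)
        have hcirc : ∀ θ : ℝ, ‖g (t * Complex.exp (θ * Complex.I))‖ₑ ^ 2 =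
            ENNReal.ofReal (t ^ (2 * n)) * ‖f (t * Complex.exp (θ * Complex.I))‖ₑ ^ 2 := by
          intro θ
          have hnorm : ‖(t : ℂ) * Complex.exp (θ * Complex.I)‖ = t := by
            simp [Complex.norm_exp_ofReal_mul_I, abs_of_pos ht0]
          rw [hgf' _ (mem_puncturedDisc.2 ⟨by rwa [hnorm], by
            rw [← norm_pos_iff, hnorm]; exact ht0⟩), hnorm]
        simp only [hcirc]
        rw [lintegral_const_mul' _ _ ENNReal.ofReal_ne_top, ← mul_assoc,
          ENNReal.ofReal_mul (by positivity)]

lemma enorm_sq_eq_polar (f : BergmanSpace hα hβ) :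
    ‖f‖ₑ ^ 2 = ∫⁻ t in Set.Ioo (0 : ℝ) 1, ENNReal.ofReal (t * diskDensity α β t) *
      ∫⁻ θ in Set.Ioo (-π) π, ‖f (t * Complex.exp (θ * Complex.I))‖ₑ ^ 2 := by
  rw [enorm_sq_eq_lintegral, lintegral_diskMeasure (by fun_prop),
    lintegral_ball_eq_polar (by fun_prop)]
  refine setLIntegral_congr_fun measurableSet_Ioo fun t ht => ?_
  have hdens : ∀ θ : ℝ, diskDensity α β (t * Complex.exp (θ * Complex.I)) =
      diskDensity α β t := by
    intro θ
    simp [diskDensity, Complex.norm_exp_ofReal_mul_I]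
  simp only [hdens]
  rw [lintegral_const_mul' _ _ ENNReal.ofReal_ne_top, ENNReal.ofReal_mul ht.1.le, mul_assoc]

/-- The restriction to a diameter is bounded from the Bergman space to `L²` with weight
`weightJ`: the weight is a superposition of indicator functions of the segments `[-t, t]`, and on
each of them the Fejér–Riesz inequality bounds the integral by the one over the circle of radius
`t`. -/
lemma lintegral_diameter_le (f : BergmanSpace hα hβ) {n : ℕ} (hn : maxPoleOrder 2 β = n)
    (hβn : β ≤ n) {ξ : ℂ} (hξ0 : ξ ≠ 0) (hξ : ‖ξ‖ ≤ 1) :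
    ∫⁻ x in Set.Ioo (-1 : ℝ) 1, ENNReal.ofReal (weightJ α β 2 |x|) * ‖f (ξ * x)‖ₑ ^ 2 ≤
      ENNReal.ofReal (π * ‖ξ‖ ^ (-2 * (n : ℤ))) * ‖f‖ₑ ^ 2 := by
  set b := (ProbabilityTheory.beta (α + 1) (β + 1))⁻¹ with hb
  have hb0 : 0 < b := beta_inv_pos hα hβ
  have hpi := Real.pi_pos
  set w : ℝ → ℝ≥0∞ := fun t => ENNReal.ofReal (radialWeight α β n t) with hw
  have hwm : Measurable w := by fun_prop
  set F : ℝ → ℝ≥0∞ := fun x => ENNReal.ofReal (|x| ^ (2 * n)) * ‖f (ξ * x)‖ₑ ^ 2 with hF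
  have hFm : Measurable F := by
    have : Measurable fun x : ℝ => f (ξ * x) := f.measurable.comp (by fun_prop)
    fun_prop
  set A : Set (ℝ × ℝ) := {p | |p.1| < p.2 ∧ p.2 < 1} with hA
  have hAm : MeasurableSet A :=
    (measurableSet_lt (by fun_prop) measurable_snd).inter
      (measurableSet_lt measurable_snd measurable_const)
  set K : ℝ → ℝ → ℝ≥0∞ := fun x t => A.indicator (fun p => F p.1 * w p.2) (x, t) with hK
  have hKm : Measurable (Function.uncurry K) :=
    ((hFm.comp measurable_fst).mul (hwm.comp measurable_snd)).indicator hAm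
  calc ∫⁻ x in Set.Ioo (-1 : ℝ) 1, ENNReal.ofReal (weightJ α β 2 |x|) * ‖f (ξ * x)‖ₑ ^ 2
      ≤ ∫⁻ x in Set.Ioo (-1 : ℝ) 1, ENNReal.ofReal (2 * b) * ∫⁻ t, K x t := by
        refine setLIntegral_mono' measurableSet_Ioo fun x hx => ?_
        -- At `x = 0` the weight may be junk, but `f` vanishes at the origin by convention.
        rcases eq_or_ne x 0 with rfl | hx0
        · simp [f.eq_zero_of_notMem (z := 0) (fun h => h.2 rfl)]
        have hKx : ∫⁻ t, K x t = F x * ∫⁻ t in Set.Ioo |x| 1, w t := by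
          rw [← lintegral_const_mul _ hwm, ← lintegral_indicator measurableSet_Ioo]
          rfl
        rw [hKx]
        calc _ ≤ (ENNReal.ofReal (2 * b) * ENNReal.ofReal (|x| ^ (2 * n)) *
              ∫⁻ t in Set.Ioo |x| 1, w t) * ‖f (ξ * x)‖ₑ ^ 2 := by
              gcongr
              exact ofReal_weightJ_le hα hβ hn (abs_pos.2 hx0) (abs_lt.2 hx)
          _ = _ := by
              rw [hF]
              ring
    _ = ENNReal.ofReal (2 * b) * ∫⁻ x in Set.Ioo (-1 : ℝ) 1, ∫⁻ t, K x t :=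
        lintegral_const_mul' _ _ ENNReal.ofReal_ne_top
    _ ≤ ENNReal.ofReal (2 * b) * ∫⁻ x, ∫⁻ t, K x t := by
        gcongr
        exact Measure.restrict_le_self
    _ = ENNReal.ofReal (2 * b) * ∫⁻ t, ∫⁻ x, K x t := by
        rw [lintegral_lintegral_swap hKm.aemeasurable]
    _ = ENNReal.ofReal (2 * b) *
          ∫⁻ t in Set.Ioo (0 : ℝ) 1, w t * ∫⁻ x in Set.Ioo (-t) t, F x := by
        congr 1
        rw [← lintegral_indicator measurableSet_Ioo]
        refine lintegral_congr fun t => ?_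
        by_cases ht : t ∈ Set.Ioo (0 : ℝ) 1
        · rw [Set.indicator_of_mem ht, ← lintegral_const_mul _ hFm,
            ← lintegral_indicator measurableSet_Ioo]
          refine lintegral_congr fun x => ?_
          simp only [hK, hA, Set.indicator, Set.mem_ofPred_eq, Set.mem_Ioo, ht.2, and_true,
            abs_lt, mul_comm]
        · rw [Set.indicator_of_notMem ht]
          have : ∀ x, K x t = 0 := fun x =>
            Set.indicator_of_notMem (fun h => ht ⟨(abs_nonneg x).trans_lt h.1, h.2⟩) _
          simp [this]
    _ ≤ ENNReal.ofReal (2 * b) * ∫⁻ t in Set.Ioo (0 : ℝ) 1,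
          ENNReal.ofReal (π * ‖ξ‖ ^ (-2 * (n : ℤ)) * (2 * b)⁻¹) *
            (ENNReal.ofReal (t * diskDensity α β t) *
              ∫⁻ θ in Set.Ioo (-π) π, ‖f (t * Complex.exp (θ * Complex.I))‖ₑ ^ 2) := by
        refine mul_le_mul' le_rfl (setLIntegral_mono' measurableSet_Ioo fun t ht => ?_)
        have ht0 : 0 < t := ht.1
        have hs : 0 < 1 - t ^ 2 := by nlinarith [ht.1, ht.2]
        refine (mul_le_mul' (le_refl (w t)) (f.lintegral_segment_le hβn hξ0 hξ ht.1 ht.2)).trans ?_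
        rw [hw, ← mul_assoc, ← mul_assoc, ← mul_assoc]
        have hw0 : 0 ≤ radialWeight α β n t := by
          unfold radialWeight
          positivity
        gcongr ?_ * _
        rw [← ENNReal.ofReal_mul hw0, ← ENNReal.ofReal_mul (by positivity),
          ← ENNReal.ofReal_mul (by positivity)]
        apply ENNReal.ofReal_le_ofReal
        have hpow : t ^ (2 * β - 2 * n + 1) * t ^ (2 * n) = t * t ^ (2 * β) := by
          rw [← Real.rpow_natCast, ← Real.rpow_add ht0, mul_comm t, ← Real.rpow_add_one ht0.ne']
          congr 1
          push_cast
          ring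
        have hnt : ‖(t : ℂ)‖ = t := by simp [abs_of_pos ht0]
        unfold radialWeight diskDensity
        rw [hnt, ← hb]
        -- The two sides differ by the factor `t ≤ 1`.
        calc _ = t * (‖ξ‖ ^ (-2 * (n : ℤ)) * (1 - t ^ 2) ^ α / 2 *
              (t ^ (2 * β - 2 * n + 1) * t ^ (2 * n))) := by ring
          _ ≤ 1 * (‖ξ‖ ^ (-2 * (n : ℤ)) * (1 - t ^ 2) ^ α / 2 *
              (t ^ (2 * β - 2 * n + 1) * t ^ (2 * n))) := by
              gcongr
              exact ht.2.le
          _ = _ := by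
              rw [hpow]
              field_simp
    _ = ENNReal.ofReal (π * ‖ξ‖ ^ (-2 * (n : ℤ))) * ‖f‖ₑ ^ 2 := by
        rw [lintegral_const_mul' _ _ ENNReal.ofReal_ne_top, ← enorm_sq_eq_polar, ← mul_assoc,
          ← ENNReal.ofReal_mul (by positivity)]
        congr 2
        field_simp

end BergmanSpace

/-! ### The Toeplitz operator -/

/-- The measure on `(-1, 1)` with density `weightJ α β 2 |x|`. -/
def diameterMeasure (α β : ℝ) : Measure ℝ :=
  (volume.restrict (Set.Ioo (-1 : ℝ) 1)).withDensity fun x => ENNReal.ofReal (weightJ α β 2 |x|)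

lemma measurable_weightJ_abs (α β : ℝ) :
    Measurable fun x : ℝ => ENNReal.ofReal (weightJ α β 2 |x|) :=
  ((measurable_weightJ α β 2).comp (by fun_prop)).ennreal_ofReal

namespace BergmanSpace

lemma measurable_comp_mul (f : BergmanSpace hα hβ) (ξ : ℂ) : Measurable fun x : ℝ => f (ξ * x) :=
  f.measurable.comp (by fun_prop)

lemma eLpNorm_diameter_sq_le (f : BergmanSpace hα hβ) {ξ : ℂ} (hξ0 : ξ ≠ 0) (hξ : ‖ξ‖ ≤ 1) :
    eLpNorm (fun x : ℝ => f (ξ * x)) 2 (diameterMeasure α β) ^ 2 ≤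
      ENNReal.ofReal (π * ‖ξ‖ ^ (-2 * maxPoleOrder 2 β)) * ‖f‖ₑ ^ 2 := by
  obtain ⟨n, hn, hβn⟩ := exists_maxPoleOrder_eq hβ
  have hm := f.measurable_comp_mul ξ
  have h := eLpNorm_nnreal_pow_eq_lintegral (f := fun x : ℝ => f (ξ * x))
    (μ := diameterMeasure α β) (p := 2) two_ne_zero
  have h' : eLpNorm (fun x : ℝ => f (ξ * x)) 2 (diameterMeasure α β) ^ 2 =
      ∫⁻ x, ‖f (ξ * x)‖ₑ ^ 2 ∂(diameterMeasure α β) := by simpa using h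
  rw [h', diameterMeasure, lintegral_withDensity_eq_lintegral_mul _ (measurable_weightJ_abs α β)
    (by fun_prop), hn]
  exact f.lintegral_diameter_le hn hβn hξ0 hξ

lemma memLp_diameter (f : BergmanSpace hα hβ) {ξ : ℂ} (hξ0 : ξ ≠ 0) (hξ : ‖ξ‖ ≤ 1) :
    MemLp (fun x : ℝ => f (ξ * x)) 2 (diameterMeasure α β) := by
  refine ⟨(f.measurable_comp_mul ξ).aestronglyMeasurable, ?_⟩
  have h := (f.eLpNorm_diameter_sq_le hξ0 hξ).trans_lt (by finiteness)
  contrapose! h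
  rw [top_le_iff.1 h]
  simp

/-- The restriction operator `f ↦ (x ↦ f (ξ x))` from the Bergman space to `L²` of the diameter. -/
def restrictDiameter (hα : -1 < α) (hβ : -1 < β) {ξ : ℂ} (hξ0 : ξ ≠ 0) (hξ : ‖ξ‖ ≤ 1) :
    BergmanSpace hα hβ →L[ℂ] Lp ℂ 2 (diameterMeasure α β) :=
  LinearMap.mkContinuous
    { toFun := fun f => (f.memLp_diameter hξ0 hξ).toLp
      map_add' := fun f g => MemLp.toLp_add (f.memLp_diameter hξ0 hξ) (g.memLp_diameter hξ0 hξ)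
      map_smul' := fun c f => MemLp.toLp_const_smul c (f.memLp_diameter hξ0 hξ) }
    √(π * ‖ξ‖ ^ (-2 * maxPoleOrder 2 β)) fun f => by
      have h := f.eLpNorm_diameter_sq_le hξ0 hξ
      have hpi := Real.pi_pos
      rw [← Lp.enorm_toLp (f.memLp_diameter hξ0 hξ), ← ofReal_norm, ← ofReal_norm,
        ← ENNReal.ofReal_pow (norm_nonneg _), ← ENNReal.ofReal_pow (norm_nonneg _),
        ← ENNReal.ofReal_mul (by positivity), ENNReal.ofReal_le_ofReal_iff (by positivity)] at h
      rw [← Real.sqrt_sq (norm_nonneg f), ← Real.sqrt_mul (by positivity)]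
      exact Real.le_sqrt_of_sq_le h

lemma norm_restrictDiameter_le {ξ : ℂ} (hξ0 : ξ ≠ 0) (hξ : ‖ξ‖ ≤ 1) :
    ‖restrictDiameter hα hβ hξ0 hξ‖ ≤ √(π * ‖ξ‖ ^ (-2 * maxPoleOrder 2 β)) :=
  LinearMap.mkContinuous_norm_le _ (Real.sqrt_nonneg _) _

lemma restrictDiameter_ae_eq (f : BergmanSpace hα hβ) {ξ : ℂ} (hξ0 : ξ ≠ 0) (hξ : ‖ξ‖ ≤ 1) :
    restrictDiameter hα hβ hξ0 hξ f =ᵐ[diameterMeasure α β] fun x : ℝ => f (ξ * x) :=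
  (f.memLp_diameter hξ0 hξ).coeFn_toLp

lemma inner_restrictDiameter_ae_eq (k f : BergmanSpace hα hβ) {ξ : ℂ} (hξ0 : ξ ≠ 0)
    (hξ : ‖ξ‖ ≤ 1) :
    (fun x => inner ℂ (restrictDiameter hα hβ hξ0 hξ k x) (restrictDiameter hα hβ hξ0 hξ f x))
      =ᵐ[diameterMeasure α β] fun x : ℝ => f (ξ * x) * conj (k (ξ * x)) := by
  filter_upwards [k.restrictDiameter_ae_eq hξ0 hξ, f.restrictDiameter_ae_eq hξ0 hξ] with x hk hf
  rw [hk, hf, RCLike.inner_apply]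

end BergmanSpace

/-- The values of functions in the space are `0` outside the punctured disc, so the identity also
holds at points where the kernel has no meaning. -/
lemma toeplitzIntegrand_eq_smul (f : BergmanSpace hα hβ) {ξ z : ℂ} (hz : z ∈ puncturedDisc)
    {x : ℝ} (hx : x ∈ Set.Ioo (-1 : ℝ) 1) :
    (ENNReal.ofReal (weightJ α β 2 |x|)).toReal •
        (f (ξ * x) * conj (evalRepr hα hβ z (ξ * x))) =
      toeplitzIntegrand hα hβ ξ f z x := by
  rw [toeplitzIntegrand, ENNReal.toReal_ofReal
    (weightJ_nonneg hα hβ (abs_nonneg x) (abs_lt.2 hx).le), Complex.real_smul]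
  by_cases hmem : ξ * x ∈ puncturedDisc
  · rw [bergmanKernel_conj_symm hz hmem, mul_comm]
  · simp [f.eq_zero_of_notMem hmem]

lemma integrableOn_toeplitzIntegrand (f : BergmanSpace hα hβ) {ξ z : ℂ} (hξ0 : ξ ≠ 0)
    (hξ : ‖ξ‖ ≤ 1) (hz : z ∈ puncturedDisc) :
    IntegrableOn (toeplitzIntegrand hα hβ ξ f z) (Set.Ioo (-1) 1) := by
  have h := (integrable_congr
    ((evalRepr hα hβ z).inner_restrictDiameter_ae_eq f hξ0 hξ)).1 (L2.integrable_inner _ _)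
  rw [diameterMeasure, integrable_withDensity_iff_integrable_smul' (measurable_weightJ_abs α β)
    (Filter.Eventually.of_forall fun _ => ENNReal.ofReal_lt_top)] at h
  exact IntegrableOn.congr_fun h (fun x hx => toeplitzIntegrand_eq_smul f hz hx) measurableSet_Ioo

/-- The Toeplitz integral at `z` is `⟪S k_z, S f⟫` for the restriction `S` to the diameter and the
representer `k_z` of the evaluation at `z`. -/
lemma inner_restrictDiameter_evalRepr (f : BergmanSpace hα hβ) {ξ z : ℂ} (hξ0 : ξ ≠ 0)
    (hξ : ‖ξ‖ ≤ 1) (hz : z ∈ puncturedDisc) :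
    inner ℂ (BergmanSpace.restrictDiameter hα hβ hξ0 hξ (evalRepr hα hβ z))
        (BergmanSpace.restrictDiameter hα hβ hξ0 hξ f) =
      ∫ x in Set.Ioo (-1 : ℝ) 1, toeplitzIntegrand hα hβ ξ f z x := by
  rw [L2.inner_def, integral_congr_ae
    ((evalRepr hα hβ z).inner_restrictDiameter_ae_eq f hξ0 hξ), diameterMeasure,
    integral_withDensity_eq_integral_toReal_smul (measurable_weightJ_abs α β)
    (Filter.Eventually.of_forall fun _ => ENNReal.ofReal_lt_top)]
  exact setIntegral_congr_fun measurableSet_Ioo fun x hx => toeplitzIntegrand_eq_smul f hz hx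

end MeromorphicBergman

end

theorem mainTheorem5 {α β : ℝ} (hα : -1 < α) (hβ : -1 < β) :
    MeromorphicBergman.IsReproducingKernel hα hβ (MeromorphicBergman.bergmanKernel hα hβ) ∧
    ∀ ξ : ℂ, ξ ≠ 0 → ‖ξ‖ ≤ 1 →
      ∃ T : MeromorphicBergman.BergmanSpace hα hβ →L[ℂ] MeromorphicBergman.BergmanSpace hα hβ,
        (∀ f : MeromorphicBergman.BergmanSpace hα hβ, ∀ z ∈ MeromorphicBergman.puncturedDisc,
          IntervalIntegrable (MeromorphicBergman.toeplitzIntegrand hα hβ ξ f z)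
            MeasureTheory.volume (-1) 1 ∧
          T f z = ∫ x in (-1 : ℝ)..1, MeromorphicBergman.toeplitzIntegrand hα hβ ξ f z x) ∧
        T.IsPositive ∧
        ‖T‖ ≤ Real.pi * ‖ξ‖ ^ (-2 * MeromorphicBergman.maxPoleOrder 2 β) := by
  refine ⟨MeromorphicBergman.isReproducingKernel_bergmanKernel hα hβ, fun ξ hξ0 hξ => ?_⟩
  have hpi := Real.pi_pos
  have hle : (-1 : ℝ) ≤ 1 := by norm_num
  set S := MeromorphicBergman.BergmanSpace.restrictDiameter hα hβ hξ0 hξ with hS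
  refine ⟨S.adjoint ∘L S, fun f z hz => ⟨?_, ?_⟩,
    ContinuousLinearMap.isPositive_adjoint_comp_self S, ?_⟩
  · rw [intervalIntegrable_iff_integrableOn_Ioo_of_le hle]
    exact MeromorphicBergman.integrableOn_toeplitzIntegrand f hξ0 hξ hz
  · rw [intervalIntegral.integral_of_le hle, integral_Ioc_eq_integral_Ioo,
      ← MeromorphicBergman.inner_restrictDiameter_evalRepr f hξ0 hξ hz,
      ← MeromorphicBergman.inner_evalRepr hz, ContinuousLinearMap.comp_apply,
      ContinuousLinearMap.adjoint_inner_right]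
  · rw [ContinuousLinearMap.norm_adjoint_comp_self]
    have h := MeromorphicBergman.BergmanSpace.norm_restrictDiameter_le (hα := hα) (hβ := hβ) hξ0 hξ
    calc ‖S‖ * ‖S‖ ≤ _ := mul_self_le_mul_self (ContinuousLinearMap.opNorm_nonneg S) h
      _ = _ := Real.mul_self_sqrt (by positivity)
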